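/- **Theorem.** Let $(M_1,g_1)$ be a Riemannian manifold and $(M_2,g_2,J)$ a Kähler manifold (an almost Hermitian manifold, $J^2=-1$ and $g_2(JU,JV)=g_2(U,V)$, with $\nabla^2J=0$ for the Levi-Civita connection $\nabla^2$ of $g_2$). Let $F:M_1\to M_2$ be a slant Riemannian map with slant angle $\theta\neq\pi/2$; that is, $F$ is smooth, $g_2(F_*X,F_*Y)=g_1(X,Y)$ for all $p\in M_1$ and $X,Y\in(\ker F_{*p})^\perp$, and for every $p\in M_1$ and every non-zero $X\in(\ker F_{*p})^\perp$ the angle between $JF_*X$ and the subspace $\operatorname{range}F_{*p}\subset T_{F(p)}M_2$ equals $\theta$. For $U\in\operatorname{range}F_{*p}$ let $\omega U$ be the component of $JU$ in $(\operatorname{range}F_{*p})^\perp$. Let $\nabla^1$ be the Levi-Civita connection of $g_1$, $\nabla^F$ the pullback of $\nabla^2$ along $F$, and $\nabla^{F\perp}_XV$ the $(\operatorname{range}F_*)^\perp$-component of $\nabla^F_XV$. Assume that $\omega$ is parallel, i.e. $$\nabla^{F\perp}_X\big(\omega F_*Y\big)-\omega F_*(\nabla^1_XY)=0\qquad\text{for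 all }X,Y\in\Gamma((\ker F_*)^\perp).$$ Then $F$ is harmonic, i.e. its tension field $\tau(F)=\operatorname{trace}\nabla F_*$ vanishes, where $(\nabla F_*)(X,Y)=\nabla^F_X(F_*Y)-F_*(\nabla^1_XY)$, if and only if the distribution $\ker F_*$ is minimal, i.e. its mean curvature vector $\frac1r\sum_{i=1}^r(\nabla^1_{v_i}v_i)^\perp$ vanishes everywhere, where $v_1,\dots,v_r$ are local orthonormal sections of $\ker F_*$ (no condition where $r=0$) and $\perp$ denotes the component in $(\ker F_*)^\perp$. -/

import Mathlib

open Bundle Manifold ContDiff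

set_option linter.unusedSectionVars false
noncomputable section

namespace SlantRiemannian

section Basic
variable {E : Type*} [NormedAddCommGroup E] [NormedSpace ℝ E]
  {M : Type*} [TopologicalSpace M] [ChartedSpace E M]

instance finiteDimensionalTangentSpace [FiniteDimensional ℝ E] (x : M) :
    FiniteDimensional ℝ (TangentSpace 𝓘(ℝ, E) x) :=
  inferInstanceAs (FiniteDimensional ℝ E)

variable [IsManifold 𝓘(ℝ, E) ∞ M]

/-- Components of a tangent vector at `y` in the coordinate frame of the preferred chart at `x`
(meaningful for `y` in the domain of that chart). -/
def toCoord (x y : M) : TangentSpace 𝓘(ℝ, E) y →L[ℝ] E :=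
  (trivializationAt E (TangentSpace 𝓘(ℝ, E) : M → Type _) x).continuousLinearMapAt ℝ y

/-- The tangent vector at `y` with given components in the coordinate frame of the preferred chart
at `x` (meaningful for `y` in the domain of that chart). -/
def ofCoord (x y : M) : E →L[ℝ] TangentSpace 𝓘(ℝ, E) y :=
  (trivializationAt E (TangentSpace 𝓘(ℝ, E) : M → Type _) x).symmL ℝ y

theorem differentiableAt_chart {W : Type*} [NormedAddCommGroup W] [NormedSpace ℝ W] {u : M → W}
    {x : M} (hu : MDifferentiableAt 𝓘(ℝ, E) 𝓘(ℝ, W) u x) :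
    DifferentiableAt ℝ (u ∘ (extChartAt 𝓘(ℝ, E) x).symm) (extChartAt 𝓘(ℝ, E) x x) := by
  have h := hu.differentiableWithinAt_writtenInExtChartAt
  simp only [modelWithCornersSelf_coe, Set.range_id] at h
  exact differentiableWithinAt_univ.1 h

theorem mvfderiv_eq_fderiv {W : Type*} [NormedAddCommGroup W] [NormedSpace ℝ W] {u : M → W}
    {x : M} (hu : MDifferentiableAt 𝓘(ℝ, E) 𝓘(ℝ, W) u x) (v : TangentSpace 𝓘(ℝ, E) x) :
    mvfderiv 𝓘(ℝ, E) u x v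
      = fderiv ℝ (u ∘ (extChartAt 𝓘(ℝ, E) x).symm) (extChartAt 𝓘(ℝ, E) x x) (v : E) := by
  rw [mvfderiv, hu.mfderiv]
  simp only [modelWithCornersSelf_coe, Set.range_id, fderivWithin_univ]
  rfl

theorem mvfderiv_clm_apply₂ {W : Type*} [NormedAddCommGroup W] [NormedSpace ℝ W]
    {G : M → (W →L[ℝ] W →L[ℝ] ℝ)} {s t : M → W} {x : M}
    (hG : MDifferentiableAt 𝓘(ℝ, E) 𝓘(ℝ, W →L[ℝ] W →L[ℝ] ℝ) G x)
    (hs : MDifferentiableAt 𝓘(ℝ, E) 𝓘(ℝ, W) s x) (ht : MDifferentiableAt 𝓘(ℝ, E) 𝓘(ℝ, W) t x)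
    (v : TangentSpace 𝓘(ℝ, E) x) :
    mvfderiv 𝓘(ℝ, E) (fun y => G y (s y) (t y)) x v
      = mvfderiv 𝓘(ℝ, E) G x v (s x) (t x) + G x (mvfderiv 𝓘(ℝ, E) s x v) (t x)
        + G x (s x) (mvfderiv 𝓘(ℝ, E) t x v) := by
  have h1 := ((differentiableAt_chart hG).hasFDerivAt.clm_apply
    (differentiableAt_chart hs).hasFDerivAt).clm_apply (differentiableAt_chart ht).hasFDerivAt
  have hx : (extChartAt 𝓘(ℝ, E) x).symm (extChartAt 𝓘(ℝ, E) x x) = x := extChartAt_to_inv x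
  rw [mvfderiv_eq_fderiv ((hG.clm_apply hs).clm_apply ht), mvfderiv_eq_fderiv hG,
    mvfderiv_eq_fderiv hs, mvfderiv_eq_fderiv ht]
  refine (DFunLike.congr_fun h1.fderiv (v : E)).trans ?_
  simp only [Function.comp_apply, hx]
  set φ := extChartAt 𝓘(ℝ, E) x
  change G x (s x) (fderiv ℝ (t ∘ φ.symm) (φ x) (v : E))
    + (G x (fderiv ℝ (s ∘ φ.symm) (φ x) (v : E)) (t x)
      + fderiv ℝ (G ∘ φ.symm) (φ x) (v : E) (s x) (t x)) = _
  ring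

end Basic

section LeviCivita
variable {E : Type*} [NormedAddCommGroup E] [NormedSpace ℝ E] [FiniteDimensional ℝ E]
  {M : Type*} [TopologicalSpace M] [ChartedSpace E M] [IsManifold 𝓘(ℝ, E) ∞ M]
  [RiemannianBundle (fun x : M => TangentSpace 𝓘(ℝ, E) x)]

/-- The Riemannian metric at `y`, written in the coordinate frame of the chart at `x`. -/
def metricCoord (x y : M) : E →L[ℝ] E →L[ℝ] ℝ :=
  (innerSL ℝ (E := TangentSpace 𝓘(ℝ, E) y)).bilinearComp (ofCoord x y) (ofCoord x y)

/-- The derivative in the direction `v` of the metric coefficient `g(w, z)`, where `w` and `z` are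
extended with constant coordinates in the chart at `x`. -/
def metricDeriv (x : M) (v w z : TangentSpace 𝓘(ℝ, E) x) : ℝ :=
  mvfderiv 𝓘(ℝ, E) (metricCoord (E := E) x) x v (toCoord x x w) (toCoord x x z)

set_option synthInstance.maxHeartbeats 200000 in
theorem metricDeriv_add₁ (x : M) (v v' w z : TangentSpace 𝓘(ℝ, E) x) :
    metricDeriv x (v + v') w z = metricDeriv x v w z + metricDeriv x v' w z := by
  simp only [metricDeriv, map_add, add_apply]

set_option synthInstance.maxHeartbeats 200000 in
theorem metricDeriv_smul₁ (x : M) (c : ℝ) (v w z : TangentSpace 𝓘(ℝ, E) x) :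
    metricDeriv x (c • v) w z = c * metricDeriv x v w z := by
  simp only [metricDeriv, map_smul, smul_apply, smul_eq_mul]

set_option synthInstance.maxHeartbeats 200000 in
theorem metricDeriv_add₂ (x : M) (v w w' z : TangentSpace 𝓘(ℝ, E) x) :
    metricDeriv x v (w + w') z = metricDeriv x v w z + metricDeriv x v w' z := by
  simp only [metricDeriv, map_add, add_apply]

set_option synthInstance.maxHeartbeats 200000 in
theorem metricDeriv_smul₂ (x : M) (c : ℝ) (v w z : TangentSpace 𝓘(ℝ, E) x) :
    metricDeriv x v (c • w) z = c * metricDeriv x v w z := by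
  simp only [metricDeriv, map_smul, smul_apply, smul_eq_mul]

theorem metricDeriv_add₃ (x : M) (v w z z' : TangentSpace 𝓘(ℝ, E) x) :
    metricDeriv x v w (z + z') = metricDeriv x v w z + metricDeriv x v w z' := by
  simp only [metricDeriv, map_add]

theorem metricDeriv_smul₃ (x : M) (c : ℝ) (v w z : TangentSpace 𝓘(ℝ, E) x) :
    metricDeriv x v w (c • z) = c * metricDeriv x v w z := by
  simp only [metricDeriv, map_smul, smul_eq_mul]

/-- Christoffel symbols of the first kind, `Γ_{ij,k} = (∂_i g_{jk} + ∂_j g_{ik} - ∂_k g_{ij}) / 2`,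
at the centre `x` of the chart. -/
def christoffelForm (x : M) (v w : TangentSpace 𝓘(ℝ, E) x) : TangentSpace 𝓘(ℝ, E) x →L[ℝ] ℝ :=
  LinearMap.toContinuousLinearMap
    { toFun := fun z => (metricDeriv x v w z + metricDeriv x w v z - metricDeriv x z v w) / 2
      map_add' := fun z z' => by
        simp only [metricDeriv_add₁, metricDeriv_add₃]; ring
      map_smul' := fun c z => by
        simp only [metricDeriv_smul₁, metricDeriv_smul₃, smul_eq_mul, RingHom.id_apply]; ring }

theorem christoffelForm_apply (x : M) (v w z : TangentSpace 𝓘(ℝ, E) x) :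
    christoffelForm x v w z
      = (metricDeriv x v w z + metricDeriv x w v z - metricDeriv x z v w) / 2 := rfl

/-- Christoffel symbols of the second kind at the centre `x` of the chart: `christoffel x w v` is
`Γ_x(v, w)`, obtained from the symbols of the first kind by raising an index. -/
def christoffel (x : M) (w : TangentSpace 𝓘(ℝ, E) x) :
    TangentSpace 𝓘(ℝ, E) x →L[ℝ] TangentSpace 𝓘(ℝ, E) x :=
  LinearMap.toContinuousLinearMap
    { toFun := fun v =>
        (InnerProductSpace.toDual ℝ (TangentSpace 𝓘(ℝ, E) x)).symm (christoffelForm x v w)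
      map_add' := fun v v' => by
        rw [← map_add]; congr 1; ext z
        simp only [christoffelForm_apply, add_apply, metricDeriv_add₁, metricDeriv_add₂]; ring
      map_smul' := fun c v => by
        rw [RingHom.id_apply, ← map_smul]; congr 1; ext z
        simp only [christoffelForm_apply, smul_apply, metricDeriv_smul₁, metricDeriv_smul₂, smul_eq_mul]
        ring }

theorem inner_christoffel (x : M) (v w z : TangentSpace 𝓘(ℝ, E) x) :
    inner ℝ (christoffel x w v) z
      = (metricDeriv x v w z + metricDeriv x w v z - metricDeriv x z v w) / 2 := by
  rw [← christoffelForm_apply]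
  exact InnerProductSpace.toDual_symm_apply

theorem christoffel_add (x : M) (w w' : TangentSpace 𝓘(ℝ, E) x) :
    christoffel x (w + w') = christoffel x w + christoffel x w' := by
  ext1 v
  refine ext_inner_right ℝ fun z => ?_
  simp only [add_apply, inner_add_left, inner_christoffel, metricDeriv_add₁, metricDeriv_add₂, metricDeriv_add₃]
  ring

theorem christoffel_smul (x : M) (c : ℝ) (w : TangentSpace 𝓘(ℝ, E) x) :
    christoffel x (c • w) = c • christoffel x w := by
  ext1 v
  refine ext_inner_right ℝ fun z => ?_
  simp only [smul_apply, real_inner_smul_left, inner_christoffel, metricDeriv_smul₁, metricDeriv_smul₂, metricDeriv_smul₃]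
  ring

theorem mdifferentiableAt_toCoord {x : M} {σ : Π y : M, TangentSpace 𝓘(ℝ, E) y} 
    (hσ : MDiffAt (T% σ) x) : MDiffAt (fun y => toCoord x y (σ y)) x := by
  rw [mdifferentiableAt_section] at hσ
  refine hσ.congr_of_eventuallyEq ?_
  filter_upwards [(trivializationAt E (TangentSpace 𝓘(ℝ, E) : M → Type _) x).open_baseSet.mem_nhds
    (FiberBundle.mem_baseSet_trivializationAt' x)] with y hy
  rw [toCoord, Trivialization.continuousLinearMapAt_apply, Trivialization.coe_linearMapAt_of_mem _ hy]

theorem ofCoord_toCoord (x : M) (v : TangentSpace 𝓘(ℝ, E) x) : ofCoord x x (toCoord x x v) = v := by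
  unfold ofCoord toCoord
  exact Trivialization.symmL_continuousLinearMapAt _ (FiberBundle.mem_baseSet_trivializationAt' x) v

/-- The Levi-Civita connection. `leviCivita Y x v` is `∇_v Y` at `x`, given by the classical formula
`∂_v Y + Γ(v, Y)` in the chart at `x`. It is compatible with the metric (`leviCivita_metric`) and
torsion-free (`leviCivita_torsion`), which characterizes it. -/
def leviCivita : CovariantDerivative 𝓘(ℝ, E) E (TangentSpace 𝓘(ℝ, E) : M → Type _) where
  toFun Y x := ofCoord x x ∘L mvfderiv 𝓘(ℝ, E) (fun y => toCoord x y (Y y)) x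
      + christoffel x (Y x)
  isCovariantDerivativeOnUniv :=
    { add := by
        intro σ σ' x hσ hσ' _
        have h : (fun y => toCoord x y ((σ + σ') y))
            = (fun y => toCoord x y (σ y)) + fun y => toCoord x y (σ' y) := by
          funext y; simp
        rw [h, mvfderiv_add (mdifferentiableAt_toCoord hσ) (mdifferentiableAt_toCoord hσ')]
        simp only [Pi.add_apply, christoffel_add, ContinuousLinearMap.comp_add]
        abel
      leibniz := by
        intro σ g x hσ hg _
        have h : (fun y => toCoord x y ((g • σ) y))
            = g • (fun y => toCoord x y (σ y)) := by
          funext y; simp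
        rw [h, mvfderiv_smul hg (mdifferentiableAt_toCoord hσ)]
        ext v
        simp [christoffel_smul, ofCoord_toCoord]
        module }


theorem toCoord_extend_eventually (x : M) (w : TangentSpace 𝓘(ℝ, E) x) :
    ∀ᶠ y in nhds x, toCoord x y (FiberBundle.extend E w y) = toCoord x x w := by
  filter_upwards [(trivializationAt E (TangentSpace 𝓘(ℝ, E) : M → Type _) x).open_baseSet.mem_nhds
    (FiberBundle.mem_baseSet_trivializationAt' x)] with y hy
  have hx := FiberBundle.mem_baseSet_trivializationAt E (TangentSpace 𝓘(ℝ, E) : M → Type _) x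
  simp only [toCoord, FiberBundle.extend, Trivialization.continuousLinearMapAt_apply, Trivialization.coe_linearMapAt_of_mem _ hy, Trivialization.coe_linearMapAt_of_mem _ hx]
  have hsymm := congrArg Prod.snd (Trivialization.apply_mk_symm (trivializationAt E (TangentSpace 𝓘(ℝ, E) : M → Type _) x) hy
    (trivializationAt E (TangentSpace 𝓘(ℝ, E) : M → Type _) x ⟨x, w⟩).2)
  exact hsymm

theorem leviCivita_extend (x : M) (w : TangentSpace 𝓘(ℝ, E) x) :
    leviCivita (FiberBundle.extend E w) x = christoffel x w := by
  have h : mvfderiv 𝓘(ℝ, E) (fun y => toCoord x y (FiberBundle.extend E w y)) x = 0 := by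
    rw [mvfderiv, Filter.EventuallyEq.mfderiv_eq (toCoord_extend_eventually x w)]
    exact mvfderiv_const _
  show ofCoord x x ∘L mvfderiv 𝓘(ℝ, E) (fun y => toCoord x y (FiberBundle.extend E w y)) x
      + christoffel x (FiberBundle.extend E w x) = _
  rw [h]; simp

variable [IsContMDiffRiemannianBundle 𝓘(ℝ, E) ∞ E (fun x : M => TangentSpace 𝓘(ℝ, E) x)]

set_option synthInstance.maxHeartbeats 200000 in
theorem mdifferentiableAt_metricCoord (x : M) :
    MDifferentiableAt 𝓘(ℝ, E) 𝓘(ℝ, E →L[ℝ] E →L[ℝ] ℝ) (metricCoord (E := E) x) x := by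
  obtain ⟨g, hg, hg'⟩ := IsContMDiffRiemannianBundle.exists_contMDiff (IB := 𝓘(ℝ, E)) (n := ∞) (F := E) (E := (fun x : M => TangentSpace 𝓘(ℝ, E) x))
  have h1 := ((contMDiffAt_section _).1 (hg.contMDiffAt (x := x))).mdifferentiableAt (by simp)
  refine h1.congr_of_eventuallyEq ?_
  filter_upwards [(trivializationAt E (TangentSpace 𝓘(ℝ, E) : M → Type _) x).open_baseSet.mem_nhds
    (FiberBundle.mem_baseSet_trivializationAt' x)] with y hy
  ext u w
  simp [hom_trivializationAt_apply, ContinuousLinearMap.inCoordinates, metricCoord, hg', ofCoord]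
  rw [Trivialization.coe_linearMapAt_of_mem _ (by
    rw [hom_trivializationAt_baseSet]; exact ⟨hy, Set.mem_univ _⟩)]
  simp [hom_trivializationAt_apply, ContinuousLinearMap.inCoordinates]

theorem metricDeriv_comm (x : M) (v w z : TangentSpace 𝓘(ℝ, E) x) :
    metricDeriv x v w z = metricDeriv x v z w := by
  have key (a b : E) : mvfderiv 𝓘(ℝ, E) (metricCoord (E := E) x) x v a b
      = mvfderiv 𝓘(ℝ, E) (fun y => metricCoord (E := E) x y a b) x v := by
    rw [mvfderiv_clm_apply₂ (mdifferentiableAt_metricCoord x) mdifferentiableAt_const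
      mdifferentiableAt_const]
    simp [mvfderiv_const]
  have hc (y : M) (a b : E) : metricCoord (E := E) x y a b = metricCoord (E := E) x y b a :=
    real_inner_comm (ofCoord x y b) (ofCoord x y a)
  unfold metricDeriv
  rw [key, key]
  simp only [hc _ (toCoord x x w)]

theorem ofCoord_toCoord_eventually (x : M) : ∀ᶠ y in nhds x, 
    ∀ v : TangentSpace 𝓘(ℝ, E) y, ofCoord x y (toCoord x y v) = v := by
  filter_upwards [(trivializationAt E (TangentSpace 𝓘(ℝ, E) : M → Type _) x).open_baseSet.mem_nhds
    (FiberBundle.mem_baseSet_trivializationAt' x)] with y hy v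
  unfold ofCoord toCoord
  exact Trivialization.symmL_continuousLinearMapAt _ hy v

/-- The Levi-Civita connection is compatible with the metric. -/
theorem leviCivita_metric {x : M} {σ τ : Π y : M, TangentSpace 𝓘(ℝ, E) y}
    (hσ : MDiffAt (T% σ) x) (hτ : MDiffAt (T% τ) x) (v : TangentSpace 𝓘(ℝ, E) x) :
    mvfderiv 𝓘(ℝ, E) (fun y => inner ℝ (σ y) (τ y)) x v
      = inner ℝ (leviCivita σ x v) (τ x) + inner ℝ (σ x) (leviCivita τ x v) := by
  have h : (fun y => inner ℝ (σ y) (τ y))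
      =ᶠ[nhds x] fun y => metricCoord x y (toCoord x y (σ y)) (toCoord x y (τ y)) := by
    filter_upwards [ofCoord_toCoord_eventually (E := E) x] with y hy
    simp [metricCoord, hy]
  have h1 : mvfderiv 𝓘(ℝ, E) (fun y => inner ℝ (σ y) (τ y)) x = mvfderiv 𝓘(ℝ, E)
      (fun y => metricCoord x y (toCoord x y (σ y)) (toCoord x y (τ y))) x := by
    rw [mvfderiv, mvfderiv, h.mfderiv_eq]; rfl
  rw [h1, mvfderiv_clm_apply₂ (mdifferentiableAt_metricCoord x) (mdifferentiableAt_toCoord hσ)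
    (mdifferentiableAt_toCoord hτ)]
  have e (ρ : Π y : M, TangentSpace 𝓘(ℝ, E) y) : leviCivita ρ x v
      = ofCoord x x (mvfderiv 𝓘(ℝ, E) (fun y => toCoord x y (ρ y)) x v) + christoffel x (ρ x) v := rfl
  rw [e, e, inner_add_left, inner_add_right, real_inner_comm (christoffel x (τ x) v) (σ x), inner_christoffel,
    inner_christoffel]
  have h2 : metricDeriv x (σ x) v (τ x) = metricDeriv x (σ x) (τ x) v := metricDeriv_comm ..
  have h3 : metricDeriv x (τ x) v (σ x) = metricDeriv x (τ x) (σ x) v := metricDeriv_comm ..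
  have h4 : metricDeriv x v (τ x) (σ x) = metricDeriv x v (σ x) (τ x) := metricDeriv_comm ..
  have h5 (a : E) : metricCoord x x a (toCoord x x (τ x)) = inner ℝ (ofCoord x x a) (τ x) := by
    simp [metricCoord, ofCoord_toCoord]
  have h6 (a : E) : metricCoord x x (toCoord x x (σ x)) a = inner ℝ (σ x) (ofCoord x x a) := by
    simp [metricCoord, ofCoord_toCoord]
  rw [h5, h6, h2, h3, h4, real_inner_comm (ofCoord x x _) (σ x)]
  unfold metricDeriv
  ring

theorem mpullbackWithin_extend_eventually (x : M) (w : TangentSpace 𝓘(ℝ, E) x) :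
    VectorField.mpullbackWithin 𝓘(ℝ, E) 𝓘(ℝ, E) (extChartAt 𝓘(ℝ, E) x).symm
        (FiberBundle.extend E w) (Set.range 𝓘(ℝ, E))
      =ᶠ[nhds (extChartAt 𝓘(ℝ, E) x x)] fun _ => toCoord x x w := by
  filter_upwards [extChartAt_target_mem_nhds (I := 𝓘(ℝ, E)) x] with z hz
  have hy : (extChartAt 𝓘(ℝ, E) x).symm z ∈ (chartAt E x).source := by
    simpa using (extChartAt 𝓘(ℝ, E) x).map_target hz
  refine (isInvertible_mfderivWithin_extChartAt_symm hz).inverse_apply_eq.2 ?_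
  have h := TangentBundle.symmL_trivializationAt (I := 𝓘(ℝ, E)) (𝕜 := ℝ) hy
  rw [(extChartAt 𝓘(ℝ, E) x).right_inv hz] at h
  have h' := congrArg (fun L : E →L[ℝ] TangentSpace 𝓘(ℝ, E) ((extChartAt 𝓘(ℝ, E) x).symm z) => L (toCoord x x w)) h
  refine Eq.trans ?_ h'
  have hx := FiberBundle.mem_baseSet_trivializationAt E (TangentSpace 𝓘(ℝ, E) : M → Type _) x
  simp only [FiberBundle.extend, toCoord, Trivialization.continuousLinearMapAt_apply,
    Trivialization.coe_linearMapAt_of_mem _ hx]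
  exact (Trivialization.symmL_apply _ (by simpa using hy) _).symm

/-- The Levi-Civita connection is torsion-free. -/
theorem leviCivita_torsion :
    (leviCivita (E := E) (M := M)).torsion = 0 := by
  ext x v w
  rw [CovariantDerivative.torsion_apply_eq_extend, leviCivita_extend, leviCivita_extend]
  have hb : VectorField.mlieBracket 𝓘(ℝ, E) (FiberBundle.extend E v) (FiberBundle.extend E w) x
      = 0 := by
    rw [VectorField.mlieBracket, VectorField.mlieBracketWithin_apply,
      (mpullbackWithin_extend_eventually x v).lieBracketWithin_vectorField_eq_nhds
        (mpullbackWithin_extend_eventually x w)]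
    simp only [VectorField.lieBracketWithin, fderivWithin_fun_const, Pi.zero_apply, zero_apply, sub_zero]
    exact map_zero _
  have hs : christoffel x w v = christoffel x v w := by
    refine ext_inner_right ℝ fun z => ?_
    rw [inner_christoffel, inner_christoffel, metricDeriv_comm x z w v]
    ring
  simp [hb, hs]

end LeviCivita

section Distributions

variable {E : Type*} [NormedAddCommGroup E] [NormedSpace ℝ E] [FiniteDimensional ℝ E]
  {M : Type*} [TopologicalSpace M] [ChartedSpace E M] [IsManifold 𝓘(ℝ, E) ∞ M]

/-- Smooth vector fields. -/
def IsSmoothField (X : Π q : M, TangentSpace 𝓘(ℝ, E) q) : Prop :=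
  ContMDiff 𝓘(ℝ, E) (𝓘(ℝ, E).prod 𝓘(ℝ, E)) ∞ (fun q => (⟨q, X q⟩ : TangentBundle 𝓘(ℝ, E) M))

variable [RiemannianBundle (fun x : M => TangentSpace 𝓘(ℝ, E) x)]

/-- A (smooth) distribution `D` is minimal if its mean curvature vector
`(1 / r) ∑ i, (∇_{v i} (v i))^⊥` vanishes at every point `p`, where `r` is the rank of `D` and the
`v i` are smooth sections of `D` that are orthonormal at `p`. -/
def IsMinimalDistribution (D : Π q : M, Submodule ℝ (TangentSpace 𝓘(ℝ, E) q)) : Prop :=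
  ∀ (p : M) (v : Fin (Module.finrank ℝ (D p)) → Π q : M, TangentSpace 𝓘(ℝ, E) q),
    (∀ i, IsSmoothField (v i)) → (∀ i q, v i q ∈ D q) → Orthonormal ℝ (fun i => v i p) →
    (Module.finrank ℝ (D p) : ℝ)⁻¹ • ∑ i, (D p)ᗮ.starProjection (leviCivita (v i) p (v i p)) = 0

/-- Almost Hermitian structures compatible with the given Riemannian metric: smooth `(1,1)`-tensor
fields `J` with `J ^ 2 = -1` and `g(J v, J w) = g(v, w)`. -/
structure IsAlmostHermitian (J : Π y : M, TangentSpace 𝓘(ℝ, E) y →L[ℝ] TangentSpace 𝓘(ℝ, E) y) :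
    Prop where
  smooth : ContMDiff 𝓘(ℝ, E) (𝓘(ℝ, E).prod 𝓘(ℝ, E →L[ℝ] E)) ∞
    (fun y => TotalSpace.mk' (E →L[ℝ] E)
      (E := fun y : M => TangentSpace 𝓘(ℝ, E) y →L[ℝ] TangentSpace 𝓘(ℝ, E) y) y (J y))
  sq : ∀ y v, J y (J y v) = -v
  isometric : ∀ y v w, Inner.inner ℝ (J y v) (J y w) = Inner.inner ℝ v w

/-- Kähler structures: almost Hermitian structures with `(∇_X J) Y = ∇_X (J Y) - J (∇_X Y) = 0` for
all smooth vector fields `X`, `Y`. -/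
structure IsKahler (J : Π y : M, TangentSpace 𝓘(ℝ, E) y →L[ℝ] TangentSpace 𝓘(ℝ, E) y) : Prop
    extends IsAlmostHermitian J where
  parallel : ∀ X Y : Π y : M, TangentSpace 𝓘(ℝ, E) y, IsSmoothField X → IsSmoothField Y →
    ∀ y, leviCivita (fun z => J z (Y z)) y (X y) - J y (leviCivita Y y (X y)) = 0

end Distributions

section Maps

variable (E₁ : Type*) [NormedAddCommGroup E₁] [NormedSpace ℝ E₁] [FiniteDimensional ℝ E₁]
  (E₂ : Type*) [NormedAddCommGroup E₂] [NormedSpace ℝ E₂] [FiniteDimensional ℝ E₂]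
  {M₁ : Type*} [TopologicalSpace M₁] [ChartedSpace E₁ M₁] [IsManifold 𝓘(ℝ, E₁) ∞ M₁]
  [RiemannianBundle (fun x : M₁ => TangentSpace 𝓘(ℝ, E₁) x)]
  {M₂ : Type*} [TopologicalSpace M₂] [ChartedSpace E₂ M₂] [IsManifold 𝓘(ℝ, E₂) ∞ M₂]
  [RiemannianBundle (fun y : M₂ => TangentSpace 𝓘(ℝ, E₂) y)]

/-- The differential `F_*` at `p`. -/
def differential (F : M₁ → M₂) (p : M₁) :
    TangentSpace 𝓘(ℝ, E₁) p →L[ℝ] TangentSpace 𝓘(ℝ, E₂) (F p) :=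
  mfderiv 𝓘(ℝ, E₁) 𝓘(ℝ, E₂) F p

/-- The vertical space `ker F_*` at `p`. -/
def kerAt (F : M₁ → M₂) (p : M₁) : Submodule ℝ (TangentSpace 𝓘(ℝ, E₁) p) :=
  LinearMap.ker (differential E₁ E₂ F p).toLinearMap

/-- The horizontal space `(ker F_*)^⊥` at `p`. -/
def horizontalAt (F : M₁ → M₂) (p : M₁) : Submodule ℝ (TangentSpace 𝓘(ℝ, E₁) p) :=
  (kerAt E₁ E₂ F p)ᗮ

/-- The space `range F_*` at `p`, inside the tangent space at `F p`. -/
def rangeAt (F : M₁ → M₂) (p : M₁) : Submodule ℝ (TangentSpace 𝓘(ℝ, E₂) (F p)) :=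
  LinearMap.range (differential E₁ E₂ F p).toLinearMap

/-- The pullback along `F` of the Levi-Civita connection of the target. For a vector field `V`
along `F`, `pullbackCov E₁ E₂ F V p v` is `∇^F_v V` at `p`, given by `∂_v V + Γ(F_* v, V)` in the
chart at `F p`. It satisfies `∇^F_v (Y ∘ F) = ∇_{F_* v} Y` (`pullbackCov_comp`), is additive
(`pullbackCov_add`) and satisfies the Leibniz rule (`pullbackCov_smul`), which characterizes it. -/
def pullbackCov (F : M₁ → M₂) (V : Π q : M₁, TangentSpace 𝓘(ℝ, E₂) (F q)) (p : M₁) :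
    TangentSpace 𝓘(ℝ, E₁) p →L[ℝ] TangentSpace 𝓘(ℝ, E₂) (F p) :=
  ofCoord (F p) (F p) ∘L mvfderiv 𝓘(ℝ, E₁) (fun q => toCoord (F p) (F q) (V q)) p
    + christoffel (F p) (V p) ∘L differential E₁ E₂ F p

variable {E₁ E₂} in
theorem pullbackCov_comp {F : M₁ → M₂} {Y : Π y : M₂, TangentSpace 𝓘(ℝ, E₂) y} {p : M₁}
    (hF : MDifferentiableAt 𝓘(ℝ, E₁) 𝓘(ℝ, E₂) F p) (hY : MDiffAt (T% Y) (F p)) :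
    pullbackCov E₁ E₂ F (fun q => Y (F q)) p = leviCivita Y (F p) ∘L differential E₁ E₂ F p := by
  have h : mvfderiv 𝓘(ℝ, E₁) (fun q => toCoord (F p) (F q) (Y (F q))) p
      = mvfderiv 𝓘(ℝ, E₂) (fun y => toCoord (F p) y (Y y)) (F p)
        ∘L mfderiv 𝓘(ℝ, E₁) 𝓘(ℝ, E₂) F p :=
    mfderiv_comp (I'' := 𝓘(ℝ, E₂)) (g := fun y => toCoord (F p) y (Y y)) p
      (mdifferentiableAt_toCoord hY) hF
  unfold pullbackCov
  rw [h]
  rfl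

variable {E₁ E₂} in
theorem mdifferentiableAt_toCoord_along {F : M₁ → M₂}
    {V : Π q : M₁, TangentSpace 𝓘(ℝ, E₂) (F q)} {p : M₁}
    (hV : MDifferentiableAt 𝓘(ℝ, E₁) (𝓘(ℝ, E₂).prod 𝓘(ℝ, E₂))
      (fun q => (⟨F q, V q⟩ : TangentBundle 𝓘(ℝ, E₂) M₂)) p) :
    MDifferentiableAt 𝓘(ℝ, E₁) 𝓘(ℝ, E₂) (fun q => toCoord (F p) (F q) (V q)) p := by
  have h0 := (mdifferentiableAt_totalSpace _ _).1 hV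
  have hF : ContinuousAt F p := h0.1.continuousAt
  refine h0.2.congr_of_eventuallyEq ?_
  filter_upwards [hF ((trivializationAt E₂ (TangentSpace 𝓘(ℝ, E₂) : M₂ → Type _)
    (F p)).open_baseSet.mem_nhds (FiberBundle.mem_baseSet_trivializationAt' (F p)))] with q hq
  simp only [toCoord]
  rw [Trivialization.continuousLinearMapAt_apply, Trivialization.coe_linearMapAt_of_mem _ hq]

variable {E₁ E₂} in
theorem pullbackCov_add {F : M₁ → M₂} {V W : Π q : M₁, TangentSpace 𝓘(ℝ, E₂) (F q)} {p : M₁}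
    (hV : MDifferentiableAt 𝓘(ℝ, E₁) (𝓘(ℝ, E₂).prod 𝓘(ℝ, E₂))
      (fun q => (⟨F q, V q⟩ : TangentBundle 𝓘(ℝ, E₂) M₂)) p)
    (hW : MDifferentiableAt 𝓘(ℝ, E₁) (𝓘(ℝ, E₂).prod 𝓘(ℝ, E₂))
      (fun q => (⟨F q, W q⟩ : TangentBundle 𝓘(ℝ, E₂) M₂)) p) :
    pullbackCov E₁ E₂ F (fun q => V q + W q) p
      = pullbackCov E₁ E₂ F V p + pullbackCov E₁ E₂ F W p := by
  have h : (fun q => toCoord (F p) (F q) (V q + W q))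
      = (fun q => toCoord (F p) (F q) (V q)) + fun q => toCoord (F p) (F q) (W q) := by
    funext y; simp
  unfold pullbackCov
  rw [h, mvfderiv_add (mdifferentiableAt_toCoord_along hV) (mdifferentiableAt_toCoord_along hW),
    christoffel_add, ContinuousLinearMap.comp_add, ContinuousLinearMap.add_comp]
  abel

variable {E₁ E₂} in
theorem pullbackCov_smul {F : M₁ → M₂} {f : M₁ → ℝ} {V : Π q : M₁, TangentSpace 𝓘(ℝ, E₂) (F q)}
    {p : M₁} (hf : MDifferentiableAt 𝓘(ℝ, E₁) 𝓘(ℝ, ℝ) f p)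
    (hV : MDifferentiableAt 𝓘(ℝ, E₁) (𝓘(ℝ, E₂).prod 𝓘(ℝ, E₂))
      (fun q => (⟨F q, V q⟩ : TangentBundle 𝓘(ℝ, E₂) M₂)) p) :
    pullbackCov E₁ E₂ F (fun q => f q • V q) p
      = f p • pullbackCov E₁ E₂ F V p + (mvfderiv 𝓘(ℝ, E₁) f p).smulRight (V p) := by
  have h : (fun q => toCoord (F p) (F q) (f q • V q))
      = f • fun q => toCoord (F p) (F q) (V q) := by
    funext y; simp
  unfold pullbackCov
  rw [h, mvfderiv_smul hf (mdifferentiableAt_toCoord_along hV), christoffel_smul]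
  ext v
  simp [ofCoord_toCoord]
  module

/-- The second fundamental form `(∇F_*)(v, w) = ∇^F_v (F_* Y) - F_* (∇_v Y)` at `p`, where `Y` is
the extension of `w` with constant coordinates in the chart at `p`; any other extension of `w` gives
the same value, see `secondFundamentalForm_eq`. -/
def secondFundamentalForm (F : M₁ → M₂) (p : M₁) (v w : TangentSpace 𝓘(ℝ, E₁) p) :
    TangentSpace 𝓘(ℝ, E₂) (F p) :=
  pullbackCov E₁ E₂ F (fun q => differential E₁ E₂ F q (FiberBundle.extend E₁ w q)) p v
    - differential E₁ E₂ F p (leviCivita (FiberBundle.extend E₁ w) p v)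

variable {E₁ E₂} in
/-- `(∇F_*)(v, Y) = ∇^F_v (F_* Y) - F_* (∇_v Y)` for every vector field `Y` differentiable at `p`. -/
theorem secondFundamentalForm_eq {F : M₁ → M₂} (hF : ContMDiff 𝓘(ℝ, E₁) 𝓘(ℝ, E₂) ∞ F)
    {Y : Π q : M₁, TangentSpace 𝓘(ℝ, E₁) q} {p : M₁} (hY : MDiffAt (T% Y) p)
    (v : TangentSpace 𝓘(ℝ, E₁) p) :
    secondFundamentalForm E₁ E₂ F p v (Y p)
      = pullbackCov E₁ E₂ F (fun q => differential E₁ E₂ F q (Y q)) p v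
        - differential E₁ E₂ F p (leviCivita Y p v) := by
  have hd {Y : Π q : M₁, TangentSpace 𝓘(ℝ, E₁) q} (hY : MDiffAt (T% Y) p) :
      MDifferentiableAt 𝓘(ℝ, E₁) (𝓘(ℝ, E₂).prod 𝓘(ℝ, E₂))
        (fun q => (⟨F q, differential E₁ E₂ F q (Y q)⟩ : TangentBundle 𝓘(ℝ, E₂) M₂)) p :=
    (((hF.contMDiff_tangentMap (m := 1) (by norm_cast)).contMDiffAt
      (x := (⟨p, Y p⟩ : TangentBundle 𝓘(ℝ, E₁) M₁))).mdifferentiableAt (by simp)).comp p hY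
  have hT : TensorialAt 𝓘(ℝ, E₁) E₁ (fun Y : Π q : M₁, TangentSpace 𝓘(ℝ, E₁) q =>
      pullbackCov E₁ E₂ F (fun q => differential E₁ E₂ F q (Y q)) p v
        - differential E₁ E₂ F p (leviCivita Y p v)) p :=
    { smul := by
        intro f σ hf hσ
        have h1 : (fun q => differential E₁ E₂ F q ((f • σ) q))
            = fun q => f q • differential E₁ E₂ F q (σ q) := by
          funext q; simp
        rw [h1, pullbackCov_smul hf (hd hσ), leviCivita.isCovariantDerivativeOnUniv.leibniz hσ hf]
        simp
        module
      add := by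
        intro σ τ hσ hτ
        have h1 : (fun q => differential E₁ E₂ F q ((σ + τ) q))
            = fun q => differential E₁ E₂ F q (σ q) + differential E₁ E₂ F q (τ q) := by
          funext q; simp
        rw [h1, pullbackCov_add (hd hσ) (hd hτ), leviCivita.isCovariantDerivativeOnUniv.add hσ hτ]
        simp
        abel }
  exact hT.pointwise (FiberBundle.mdifferentiableAt_extend ..) hY (by simp)

/-- The tension field, i.e. the trace of the second fundamental form. -/
def tensionField (F : M₁ → M₂) (p : M₁) : TangentSpace 𝓘(ℝ, E₂) (F p) :=
  ∑ i, secondFundamentalForm E₁ E₂ F p (stdOrthonormalBasis ℝ (TangentSpace 𝓘(ℝ, E₁) p) i)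
    (stdOrthonormalBasis ℝ (TangentSpace 𝓘(ℝ, E₁) p) i)

/-- Harmonic maps: maps with vanishing tension field. -/
def IsHarmonicMap (F : M₁ → M₂) : Prop := ∀ p, tensionField E₁ E₂ F p = 0

/-- Riemannian maps: smooth maps whose differential is isometric on `(ker F_*)^⊥`. -/
structure IsRiemannianMap (F : M₁ → M₂) : Prop where
  smooth : ContMDiff 𝓘(ℝ, E₁) 𝓘(ℝ, E₂) ∞ F
  isometric : ∀ p, ∀ v ∈ horizontalAt E₁ E₂ F p, ∀ w ∈ horizontalAt E₁ E₂ F p,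
    Inner.inner ℝ (differential E₁ E₂ F p v) (differential E₁ E₂ F p w) = Inner.inner ℝ v w

/-- Slant Riemannian maps with slant angle `θ`: Riemannian maps such that for every non-zero
horizontal vector `v` the angle between `J F_* v` and the subspace `range F_*`, i.e. the angle
between `J F_* v` and its orthogonal projection to that subspace, equals `θ`. -/
structure IsSlantRiemannianMap (F : M₁ → M₂)
    (J : Π y : M₂, TangentSpace 𝓘(ℝ, E₂) y →L[ℝ] TangentSpace 𝓘(ℝ, E₂) y) (θ : ℝ) : Prop
    extends IsRiemannianMap E₁ E₂ F where
  angle_eq : ∀ p, ∀ v ∈ horizontalAt E₁ E₂ F p, v ≠ 0 →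
    InnerProductGeometry.angle (J (F p) (differential E₁ E₂ F p v))
      ((rangeAt E₁ E₂ F p).starProjection (J (F p) (differential E₁ E₂ F p v))) = θ

/-- The `(range F_*)^⊥`-component `ω u` of `J u`. -/
def omega (F : M₁ → M₂) (J : Π y : M₂, TangentSpace 𝓘(ℝ, E₂) y →L[ℝ] TangentSpace 𝓘(ℝ, E₂) y)
    (p : M₁) (u : TangentSpace 𝓘(ℝ, E₂) (F p)) : TangentSpace 𝓘(ℝ, E₂) (F p) :=
  (rangeAt E₁ E₂ F p)ᗮ.starProjection (J (F p) u)

/-- The connection `∇^{F⊥}` on `(range F_*)^⊥`: the normal component of `∇^F_v V`. -/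
def normalCov (F : M₁ → M₂) (V : Π q : M₁, TangentSpace 𝓘(ℝ, E₂) (F q)) (p : M₁)
    (v : TangentSpace 𝓘(ℝ, E₁) p) : TangentSpace 𝓘(ℝ, E₂) (F p) :=
  (rangeAt E₁ E₂ F p)ᗮ.starProjection (pullbackCov E₁ E₂ F V p v)

/-- `ω` is parallel: `∇^{F⊥}_X (ω F_* Y) - ω F_* (∇_X Y) = 0` for all smooth horizontal vector fields
`X`, `Y`. -/
def IsOmegaParallel (F : M₁ → M₂)
    (J : Π y : M₂, TangentSpace 𝓘(ℝ, E₂) y →L[ℝ] TangentSpace 𝓘(ℝ, E₂) y) : Prop :=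
  ∀ X Y : Π q : M₁, TangentSpace 𝓘(ℝ, E₁) q, IsSmoothField X → IsSmoothField Y →
    (∀ q, X q ∈ horizontalAt E₁ E₂ F q) → (∀ q, Y q ∈ horizontalAt E₁ E₂ F q) →
    ∀ p, normalCov E₁ E₂ F (fun q => omega E₁ E₂ F J q (differential E₁ E₂ F q (Y q))) p (X p)
      - omega E₁ E₂ F J p (differential E₁ E₂ F p (leviCivita Y p (X p))) = 0

end Maps

end SlantRiemannian

end

/-! Write `A` for `F_*` at a point, `H` for its horizontal space, `B` for the second fundamental
form and `C` for the normal part of `J`. The trace of `B` splits into a vertical and a horizontal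
sum, and the slant condition together with parallel `ω` makes the horizontal sum vanish.

On `H` put `Q = A† J A`. As `A` is isometric on `H`, `A Q v` is the tangential part of `J A v`. The
slant condition says `‖Q v‖ = cos θ ‖v‖`, and skewness of `Q` turns this into `Q² = -cos² θ`
(`adjoint_conj_sq`). Taking normal parts of the derivative of `J F_* Y = F_* Q Y + ω F_* Y`,
parallelism of `J` and `ω` leaves `B(v, Q w) = C (B(v, w))` on `H`
(`IsOmegaParallel.secondFundamentalForm_adjoint`); this uses that `B` is normal-valued on `H`
(`IsRiemannianMap.secondFundamentalForm_mem`). With symmetry of `B`, `B(Q v, Q v) = C B(v, Q v) =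
B(v, Q² v) = -cos² θ B(v, v)`. Since `(cos θ)⁻¹ Q` is an isometry of `H`, the horizontal trace
equals its own negative (`sum_eq_zero_of_slant`).

The vertical trace is `-F_*` of the sum of the `(∇ vᵢ vᵢ)^⊥`, because `F_*` kills vertical fields
(`secondFundamentalForm_eq_of_vertical`). As `F_*` is injective on `H`, the tension field vanishes
exactly when the mean curvature vector does. -/

noncomputable section

namespace SlantRiemannian

/-! ### Pointwise linear algebra: traces, partial isometries and the slant operator. -/

section LinearAlgebra

variable {V W : Type*} [NormedAddCommGroup V] [InnerProductSpace ℝ V] [FiniteDimensional ℝ V]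
  [NormedAddCommGroup W] [InnerProductSpace ℝ W] [FiniteDimensional ℝ W]

/-- Both sums are the image of the canonical covariant tensor under the map induced by `B` on the
tensor product, and that tensor does not depend on the basis. -/
theorem sum_orthonormalBasis_eq {G ι κ : Type*} [AddCommGroup G] [Module ℝ G] [Fintype ι]
    [Fintype κ] (B : V →ₗ[ℝ] V →ₗ[ℝ] G) (b : OrthonormalBasis ι ℝ V)
    (c : OrthonormalBasis κ ℝ V) : ∑ i, B (b i) (b i) = ∑ j, B (c j) (c j) := by
  have h := (InnerProductSpace.canonicalCovariantTensor_eq_sum V b).symm.trans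
    (InnerProductSpace.canonicalCovariantTensor_eq_sum V c)
  simpa using congrArg (TensorProduct.lift B) h

theorem sum_orthonormalBasis_eq_add {G ι κ μ : Type*} [AddCommGroup G] [Module ℝ G] [Fintype ι]
    [Fintype κ] [Fintype μ] (B : V →ₗ[ℝ] V →ₗ[ℝ] G) (K : Submodule ℝ V)
    (b : OrthonormalBasis ι ℝ V) (c : OrthonormalBasis κ ℝ K) (d : OrthonormalBasis μ ℝ Kᗮ) :
    ∑ i, B (b i) (b i)
      = ∑ j, B (c j : V) (c j : V) + ∑ k, B (d k : V) (d k : V) := by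
  rw [sum_orthonormalBasis_eq B b ((c.prod d).map K.orthogonalDecomposition.symm)]
  simp

variable {A : V →L[ℝ] W}

theorem adjoint_mem_ker_orthogonal (A : V →L[ℝ] W) (w : W) :
    A.adjoint w ∈ (LinearMap.ker A.toLinearMap)ᗮ := by
  intro v hv
  have hv' : A v = 0 := hv
  rw [ContinuousLinearMap.adjoint_inner_right, hv', inner_zero_left]

theorem apply_eq_apply_starProjection (A : V →L[ℝ] W) (v : V) :
    A v = A ((LinearMap.ker A.toLinearMap)ᗮ.starProjection v) := by
  have h := (LinearMap.ker A.toLinearMap).starProjection_add_starProjection_orthogonal v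
  have h0 : A ((LinearMap.ker A.toLinearMap).starProjection v) = 0 :=
    (LinearMap.ker A.toLinearMap).starProjection_apply_mem v
  conv_lhs => rw [← h, map_add, h0, zero_add]

variable (hA : ∀ v ∈ (LinearMap.ker A.toLinearMap)ᗮ, ∀ w ∈ (LinearMap.ker A.toLinearMap)ᗮ,
  inner ℝ (A v) (A w) = inner ℝ v w)
include hA

theorem inner_map_map_of_mem (v : V) {w : V} (hw : w ∈ (LinearMap.ker A.toLinearMap)ᗮ) :
    inner ℝ (A v) (A w) = inner ℝ v w := by
  rw [apply_eq_apply_starProjection, hA _ (Submodule.starProjection_apply_mem _ _) _ hw,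
    Submodule.inner_starProjection_left_eq_right, Submodule.starProjection_eq_self_iff.2 hw]

/-- With `apply_adjoint_apply`, this identifies `A† A` and `A A†` as the orthogonal projections onto
the horizontal space and onto the range. It lets projections be replaced by adjoints, whose smooth
dependence on the point is easier to prove. -/
theorem adjoint_apply_apply_of_mem {v : V} (hv : v ∈ (LinearMap.ker A.toLinearMap)ᗮ) :
    A.adjoint (A v) = v := by
  refine ext_inner_left ℝ fun w => ?_
  rw [ContinuousLinearMap.adjoint_inner_right, inner_map_map_of_mem hA w hv]

theorem apply_adjoint_apply (w : W) :
    A (A.adjoint w) = (LinearMap.range A.toLinearMap).starProjection w := by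
  symm
  refine Submodule.eq_starProjection_of_mem_of_inner_eq_zero ⟨_, rfl⟩ ?_
  rintro _ ⟨v, rfl⟩
  change inner ℝ (w - A (A.adjoint w)) (A v) = 0
  rw [inner_sub_left, real_inner_comm, real_inner_comm (A v),
    inner_map_map_of_mem hA v (adjoint_mem_ker_orthogonal A w),
    ContinuousLinearMap.adjoint_inner_right, sub_self]

variable {J : W →L[ℝ] W} (hJ2 : ∀ w, J (J w) = -w) (hJ : ∀ v w, inner ℝ (J v) (J w) = inner ℝ v w)
include hJ2 hJ

theorem inner_adjoint_conj_skew (v : V) {w : V} :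
    inner ℝ (A.adjoint (J (A v))) w = - inner ℝ v (A.adjoint (J (A w))) := by
  rw [ContinuousLinearMap.adjoint_inner_left, ContinuousLinearMap.adjoint_inner_right,
    ← hJ (J (A v)), hJ2, inner_neg_left]

variable {θ : ℝ} (hθ : θ ≠ Real.pi / 2)
  (hangle : ∀ v ∈ (LinearMap.ker A.toLinearMap)ᗮ, v ≠ 0 → InnerProductGeometry.angle (J (A v))
    ((LinearMap.range A.toLinearMap).starProjection (J (A v))) = θ)
include hθ hangle

/-- The inner product of `J A v` with its projection `A Q` is `‖Q‖²`, and by the angle condition it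
is also `cos θ ‖v‖ ‖Q‖`; cancel `‖Q‖`. -/
theorem norm_adjoint_conj {v : V} (hv : v ∈ (LinearMap.ker A.toLinearMap)ᗮ) :
    ‖A.adjoint (J (A v))‖ = Real.cos θ * ‖v‖ := by
  rcases eq_or_ne v 0 with rfl | h0
  · simp
  have hQ := adjoint_mem_ker_orthogonal A (J (A v))
  set Q := A.adjoint (J (A v)) with hQdef
  have hang := hangle v hv h0
  rw [← apply_adjoint_apply hA, ← hQdef] at hang
  have n1 : ‖A Q‖ = ‖Q‖ := by
    rw [norm_eq_sqrt_real_inner, hA _ hQ _ hQ, ← norm_eq_sqrt_real_inner]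
  have n2 : ‖J (A v)‖ = ‖v‖ := by
    rw [norm_eq_sqrt_real_inner, hJ, hA _ hv _ hv, ← norm_eq_sqrt_real_inner]
  have n3 : inner ℝ (J (A v)) (A Q) = ‖Q‖ * ‖Q‖ := by
    rw [← ContinuousLinearMap.adjoint_inner_left, real_inner_self_eq_norm_mul_norm]
  -- The angle to the zero vector is `π / 2` by convention, which `hθ` excludes.
  have hQ0 : Q ≠ 0 := by
    rintro h
    rw [h, map_zero, InnerProductGeometry.angle_zero_right] at hang
    exact hθ hang.symm
  have h := InnerProductGeometry.cos_angle_mul_norm_mul_norm (J (A v)) (A Q)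
  rw [hang, n1, n2, n3, ← mul_assoc] at h
  exact (mul_right_cancel₀ (norm_ne_zero_iff.2 hQ0) h).symm

theorem cos_ne_zero_of_mem {v : V} (hv : v ∈ (LinearMap.ker A.toLinearMap)ᗮ) (h0 : v ≠ 0) :
    Real.cos θ ≠ 0 := by
  intro h
  have h1 := norm_adjoint_conj hA hJ2 hJ hθ hangle hv
  rw [h, zero_mul, norm_eq_zero] at h1
  have hang := hangle v hv h0
  rw [← apply_adjoint_apply hA, h1, map_zero, InnerProductGeometry.angle_zero_right] at hang
  exact hθ hang.symm

/-- Polarizing the norm identity gives `⟪Q v, Q w⟫ = cos² θ ⟪v, w⟫` on `H`. Skewness of `Q` then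
shows that `z = Q² v + cos² θ v`, itself in `H`, is orthogonal to itself. -/
theorem adjoint_conj_sq {v : V} (hv : v ∈ (LinearMap.ker A.toLinearMap)ᗮ) :
    A.adjoint (J (A (A.adjoint (J (A v))))) = -(Real.cos θ ^ 2 • v) := by
  set H := (LinearMap.ker A.toLinearMap)ᗮ
  have key : ∀ w ∈ H, inner ℝ (A.adjoint (J (A v))) (A.adjoint (J (A w)))
      = Real.cos θ ^ 2 * inner ℝ v w := by
    intro w hw
    have e : A.adjoint (J (A (v + w))) = A.adjoint (J (A v)) + A.adjoint (J (A w)) := by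
      simp only [map_add]
    have h1 := norm_adjoint_conj hA hJ2 hJ hθ hangle (H.add_mem hv hw)
    rw [e] at h1
    rw [real_inner_eq_norm_add_mul_self_sub_norm_mul_self_sub_norm_mul_self_div_two, h1,
      norm_adjoint_conj hA hJ2 hJ hθ hangle hv, norm_adjoint_conj hA hJ2 hJ hθ hangle hw,
      real_inner_eq_norm_add_mul_self_sub_norm_mul_self_sub_norm_mul_self_div_two]
    ring
  rw [← sub_eq_zero, sub_neg_eq_add]
  set z := A.adjoint (J (A (A.adjoint (J (A v))))) + Real.cos θ ^ 2 • v with hz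
  have hzH : z ∈ H := H.add_mem (adjoint_mem_ker_orthogonal _ _) (H.smul_mem _ hv)
  rw [← inner_self_eq_zero (𝕜 := ℝ)]
  nth_rw 1 [hz]
  rw [inner_add_left, inner_adjoint_conj_skew hA hJ2 hJ, key z hzH, real_inner_smul_left]
  ring

theorem sum_eq_zero_of_slant {G ι : Type*} [AddCommGroup G] [Module ℝ G] [Fintype ι]
    (B : V →ₗ[ℝ] V →ₗ[ℝ] G) (C : G →ₗ[ℝ] G)
    (hB : ∀ v ∈ (LinearMap.ker A.toLinearMap)ᗮ, ∀ w ∈ (LinearMap.ker A.toLinearMap)ᗮ,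
      B v w = B w v)
    (hC : ∀ v ∈ (LinearMap.ker A.toLinearMap)ᗮ, ∀ w ∈ (LinearMap.ker A.toLinearMap)ᗮ,
      B v (A.adjoint (J (A w))) = C (B v w))
    (b : OrthonormalBasis ι ℝ (LinearMap.ker A.toLinearMap)ᗮ) :
    ∑ i, B (b i : V) (b i : V) = 0 := by
  set c := Real.cos θ
  let Q : V →ₗ[ℝ] V := (A.adjoint ∘L J ∘L A).toLinearMap
  have hQ (v : V) : Q v = A.adjoint (J (A v)) := rfl
  have hQH (v : V) : Q v ∈ (LinearMap.ker A.toLinearMap)ᗮ := adjoint_mem_ker_orthogonal _ _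
  -- One factor `Q` moves across: `B(Qv, Qv) = C B(Qv, v) = C B(v, Qv) = B(v, Q² v)`.
  have hQQ {v : V} (hv : v ∈ (LinearMap.ker A.toLinearMap)ᗮ) : B (Q v) (Q v) = -(c ^ 2 • B v v) := by
    have h1 : B (Q v) (Q v) = C (B (Q v) v) := hC _ (hQH v) _ hv
    have h2 : B v (Q (Q v)) = C (B v (Q v)) := hC _ hv _ (hQH v)
    rw [h1, hB _ (hQH v) _ hv, ← h2, hQ, hQ, adjoint_conj_sq hA hJ2 hJ hθ hangle hv, map_neg,
      map_smul]
  -- If `cos θ = 0`, the horizontal space is zero and so is every summand.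
  by_cases hc : c = 0
  · refine Finset.sum_eq_zero fun i _ => ?_
    by_contra h
    refine cos_ne_zero_of_mem hA hJ2 hJ hθ hangle (b i).2 ?_ hc
    intro h0
    exact h (by rw [h0, map_zero])
  let R : (LinearMap.ker A.toLinearMap)ᗮ →ₗᵢ[ℝ] (LinearMap.ker A.toLinearMap)ᗮ :=
    { toLinearMap := c⁻¹ • (Q.comp (LinearMap.ker A.toLinearMap)ᗮ.subtype).codRestrict
        (LinearMap.ker A.toLinearMap)ᗮ (fun v => hQH v)
      norm_map' := fun v => by
        -- The sign of `c` is irrelevant here: only `|c|` enters the norm of `c⁻¹ • Q v`.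
        have h := congrArg _root_.abs (norm_adjoint_conj hA hJ2 hJ hθ hangle v.2)
        rw [abs_norm, abs_mul, abs_norm] at h
        change ‖c⁻¹ • A.adjoint (J (A v))‖ = ‖(v : V)‖
        rw [norm_smul, h, norm_inv, Real.norm_eq_abs, inv_mul_cancel_left₀ (abs_ne_zero.2 hc)] }
  -- The trace over the rotated basis `R (b i)` agrees with the trace over `b`, whereas `h'` says
  -- that each term changes sign.
  have h := sum_orthonormalBasis_eq (B.compl₁₂ (LinearMap.ker A.toLinearMap)ᗮ.subtype
    (LinearMap.ker A.toLinearMap)ᗮ.subtype) b (b.map (R.toLinearIsometryEquiv rfl))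
  have h' (i : ι) : B (R (b i) : V) (R (b i) : V) = - B (b i : V) (b i : V) := by
    change B (c⁻¹ • Q (b i)) (c⁻¹ • Q (b i)) = _
    rw [map_smul, map_smul, LinearMap.smul_apply, hQQ (b i).2, smul_neg, smul_neg, smul_smul,
      smul_smul]
    congr 1
    rw [show c⁻¹ * c⁻¹ * c ^ 2 = 1 by field_simp, one_smul]
  have h2 : ∑ i, B (b i : V) (b i : V) = ∑ i, - B (b i : V) (b i : V) := by
    rw [← Finset.sum_congr rfl fun i _ => h' i]
    exact h
  rw [Finset.sum_neg_distrib, eq_neg_iff_add_eq_zero, ← two_smul ℝ] at h2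
  exact (smul_eq_zero.1 h2).resolve_left two_ne_zero

end LinearAlgebra

/-! ### Smooth fields in coordinates and smoothness of the adjoint of the differential. -/

section Smoothness

variable {E : Type*} [NormedAddCommGroup E] [NormedSpace ℝ E] [FiniteDimensional ℝ E]
  {M : Type*} [TopologicalSpace M] [ChartedSpace E M] [IsManifold 𝓘(ℝ, E) ∞ M]
  {E' : Type*} [NormedAddCommGroup E'] [NormedSpace ℝ E'] [FiniteDimensional ℝ E']
  {N : Type*} [TopologicalSpace N] [ChartedSpace E' N] [IsManifold 𝓘(ℝ, E') ∞ N]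

theorem toCoord_ofCoord_eventually (x : M) : ∀ᶠ y in nhds x,
    ∀ w : E, toCoord x y (ofCoord x y w) = w := by
  filter_upwards [(trivializationAt E (TangentSpace 𝓘(ℝ, E) : M → Type _) x).open_baseSet.mem_nhds
    (FiberBundle.mem_baseSet_trivializationAt' x)] with y hy w
  unfold ofCoord toCoord
  exact Trivialization.continuousLinearMapAt_symmL _ hy w

theorem contMDiffAt_along_iff {F : M → N} {V : Π q : M, TangentSpace 𝓘(ℝ, E') (F q)} {p : M} :
    ContMDiffAt 𝓘(ℝ, E) (𝓘(ℝ, E').prod 𝓘(ℝ, E')) ∞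
        (fun q => (⟨F q, V q⟩ : TangentBundle 𝓘(ℝ, E') N)) p
      ↔ ContMDiffAt 𝓘(ℝ, E) 𝓘(ℝ, E') ∞ F p ∧
        ContMDiffAt 𝓘(ℝ, E) 𝓘(ℝ, E') ∞ (fun q => toCoord (F p) (F q) (V q)) p := by
  rw [contMDiffAt_totalSpace]
  refine and_congr_right fun hF => ?_
  refine Filter.EventuallyEq.contMDiffAt_iff ?_
  filter_upwards [hF.continuousAt ((trivializationAt E' (TangentSpace 𝓘(ℝ, E') : N → Type _)
    (F p)).open_baseSet.mem_nhds (FiberBundle.mem_baseSet_trivializationAt' (F p)))] with q hq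
  simp only [toCoord]
  rw [Trivialization.continuousLinearMapAt_apply, Trivialization.coe_linearMapAt_of_mem _ hq]

theorem isSmoothField_iff {X : Π q : M, TangentSpace 𝓘(ℝ, E) q} :
    IsSmoothField X ↔
      ∀ p, ContMDiffAt 𝓘(ℝ, E) 𝓘(ℝ, E) ∞ (fun q => toCoord p q (X q)) p := by
  refine forall_congr' fun p => ?_
  rw [contMDiffAt_along_iff (F := fun q : M => q)]
  exact and_iff_right contMDiffAt_id

theorem IsSmoothField.sub {X Y : Π q : M, TangentSpace 𝓘(ℝ, E) q} (hX : IsSmoothField X)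
    (hY : IsSmoothField Y) : IsSmoothField (fun q => X q - Y q) := by
  rw [isSmoothField_iff] at *
  intro p
  simpa only [map_sub] using (hX p).sub (hY p)

theorem IsSmoothField.mdifferentiableAt {X : Π q : M, TangentSpace 𝓘(ℝ, E) q}
    (hX : IsSmoothField X) (p : M) : MDiffAt (T% X) p :=
  (hX p).mdifferentiableAt (by simp)

/-- The operator is definitionally the `inTangentCoordinates` expression of `mfderiv`, so smoothness
of the derivative applies directly. -/
theorem contMDiffAt_differential {F : M → N} (hF : ContMDiff 𝓘(ℝ, E) 𝓘(ℝ, E') ∞ F) (p : M) :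
    ContMDiffAt 𝓘(ℝ, E) 𝓘(ℝ, E →L[ℝ] E') ∞
      (fun q => toCoord (F p) (F q) ∘L differential E E' F q ∘L ofCoord p q) p :=
  (hF.contMDiffAt (x := p)).mfderiv_const (m := ∞) (by simp)

theorem contMDiff_differential_apply {F : M → N} (hF : ContMDiff 𝓘(ℝ, E) 𝓘(ℝ, E') ∞ F)
    {Y : Π q : M, TangentSpace 𝓘(ℝ, E) q} (hY : IsSmoothField Y) :
    ContMDiff 𝓘(ℝ, E) (𝓘(ℝ, E').prod 𝓘(ℝ, E')) ∞
      (fun q => (⟨F q, differential E E' F q (Y q)⟩ : TangentBundle 𝓘(ℝ, E') N)) :=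
  (hF.contMDiff_tangentMap (m := ∞) (by simp)).comp hY

/-- A local smooth extension is cut off by a bump function; the Hausdorff condition makes the result
globally smooth. -/
theorem exists_isSmoothField_eq [T2Space M] {p : M} (v : TangentSpace 𝓘(ℝ, E) p) :
    ∃ X : Π q : M, TangentSpace 𝓘(ℝ, E) q, IsSmoothField X ∧ X p = v := by
  obtain ⟨s, hs, hsmooth⟩ := FiberBundle.exists_contMDiffOn_extend (k := ∞) 𝓘(ℝ, E) E v
  obtain ⟨f, -, hf⟩ := (SmoothBumpFunction.nhds_basis_tsupport (I := 𝓘(ℝ, E)) p).mem_iff.1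
    (interior_mem_nhds.2 hs)
  refine ⟨(f : M → ℝ) • FiberBundle.extend E v, ?_, by simp⟩
  exact ContMDiffOn.smul_section_of_tsupport (u := interior s) (f.contMDiff.contMDiffOn)
    isOpen_interior hf (hsmooth.mono interior_subset)

section Metric
variable [RiemannianBundle (fun x : M => TangentSpace 𝓘(ℝ, E) x)]
  [RiemannianBundle (fun x : N => TangentSpace 𝓘(ℝ, E') x)]
  [IsContMDiffRiemannianBundle 𝓘(ℝ, E) ∞ E (fun x : M => TangentSpace 𝓘(ℝ, E) x)]
  [IsContMDiffRiemannianBundle 𝓘(ℝ, E') ∞ E' (fun x : N => TangentSpace 𝓘(ℝ, E') x)]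

set_option synthInstance.maxHeartbeats 200000 in
theorem contMDiffAt_metricCoord (x : M) :
    ContMDiffAt 𝓘(ℝ, E) 𝓘(ℝ, E →L[ℝ] E →L[ℝ] ℝ) ∞ (metricCoord (E := E) x) x := by
  obtain ⟨g, hg, hg'⟩ := IsContMDiffRiemannianBundle.exists_contMDiff (IB := 𝓘(ℝ, E)) (n := ∞)
    (F := E) (E := (fun x : M => TangentSpace 𝓘(ℝ, E) x))
  have h1 := (contMDiffAt_section _).1 (hg.contMDiffAt (x := x))
  refine h1.congr_of_eventuallyEq ?_
  filter_upwards [(trivializationAt E (TangentSpace 𝓘(ℝ, E) : M → Type _) x).open_baseSet.mem_nhds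
    (FiberBundle.mem_baseSet_trivializationAt' x)] with y hy
  ext u w
  simp [hom_trivializationAt_apply, ContinuousLinearMap.inCoordinates, metricCoord, hg', ofCoord]
  rw [Trivialization.coe_linearMapAt_of_mem _ (by
    rw [hom_trivializationAt_baseSet]; exact ⟨hy, Set.mem_univ _⟩)]
  simp [hom_trivializationAt_apply, ContinuousLinearMap.inCoordinates]

theorem metricCoord_apply (x y : M) (u w : E) :
    metricCoord x y u w = inner ℝ (ofCoord x y u) (ofCoord x y w) := rfl

theorem metricCoord_isInvertible_eventually (x : M) :
    ∀ᶠ y in nhds x, (metricCoord (E := E) x y).IsInvertible := by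
  filter_upwards [toCoord_ofCoord_eventually (E := E) x] with y hy
  have hinj : Function.Injective (metricCoord (E := E) x y) := by
    refine (injective_iff_map_eq_zero _).2 fun u hu => ?_
    have h : inner ℝ (ofCoord x y u) (ofCoord x y u) = (0 : ℝ) := by
      rw [← metricCoord_apply, hu]; rfl
    rw [← hy u, inner_self_eq_zero.1 h, map_zero]
  have hd : Module.finrank ℝ E = Module.finrank ℝ (E →L[ℝ] ℝ) := by
    rw [← LinearMap.toContinuousLinearMap.finrank_eq]
    exact (Subspace.dual_finrank_eq (K := ℝ) (V := E)).symm
  exact ⟨(LinearEquiv.ofInjectiveOfFinrankEq (metricCoord (E := E) x y).toLinearMap hinj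
    hd).toContinuousLinearEquiv, by ext; rfl⟩

/-- Raising an index is smooth. -/
theorem isSmoothField_of_inner {X : Π q : M, TangentSpace 𝓘(ℝ, E) q}
    {α : M → M → E →L[ℝ] ℝ}
    (hα : ∀ p, ContMDiffAt 𝓘(ℝ, E) 𝓘(ℝ, E →L[ℝ] ℝ) ∞ (α p) p)
    (hX : ∀ p, ∀ᶠ q in nhds p, ∀ e : E, inner ℝ (X q) (ofCoord p q e) = α p q e) :
    IsSmoothField X := by
  rw [isSmoothField_iff]
  intro p
  -- Inversion is smooth at invertible operators, so the inverse metric is smooth; the coordinates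
  -- of `X` are its value on `α`.
  have hinv : ContMDiffAt 𝓘(ℝ, E) 𝓘(ℝ, (E →L[ℝ] ℝ) →L[ℝ] E) ∞
      (fun q => (metricCoord (E := E) p q).inverse) p := by
    obtain ⟨e, he⟩ := (metricCoord_isInvertible_eventually (E := E) p).self_of_nhds
    have h := contDiffAt_map_inverse (𝕜 := ℝ) (n := ∞) e
    rw [he] at h
    exact h.contMDiffAt.comp p (contMDiffAt_metricCoord p)
  refine (hinv.clm_apply (hα p)).congr_of_eventuallyEq ?_
  filter_upwards [hX p, metricCoord_isInvertible_eventually (E := E) p,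
    ofCoord_toCoord_eventually (E := E) p] with q hq hq' hq''
  rw [eq_comm, hq'.inverse_apply_eq]
  ext e
  rw [metricCoord_apply, hq'', hq]

theorem isSmoothField_adjoint {F : M → N} (hF : ContMDiff 𝓘(ℝ, E) 𝓘(ℝ, E') ∞ F)
    {V : Π q : M, TangentSpace 𝓘(ℝ, E') (F q)}
    (hV : ContMDiff 𝓘(ℝ, E) (𝓘(ℝ, E').prod 𝓘(ℝ, E')) ∞
      (fun q => (⟨F q, V q⟩ : TangentBundle 𝓘(ℝ, E') N))) :
    IsSmoothField (fun q => (differential E E' F q).adjoint (V q)) := by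
  refine isSmoothField_of_inner (α := fun p q =>
    metricCoord (F p) (F q) (toCoord (F p) (F q) (V q))
      ∘L (toCoord (F p) (F q) ∘L differential E E' F q ∘L ofCoord p q)) ?_ ?_
  · intro p
    have h1 := ((contMDiffAt_metricCoord (E := E') (F p)).comp p hF.contMDiffAt).clm_apply
      (contMDiffAt_along_iff.1 (hV p)).2
    exact h1.clm_comp (contMDiffAt_differential hF p)
  · intro p
    filter_upwards [hF.continuous.continuousAt.eventually
      (ofCoord_toCoord_eventually (E := E') (F p))] with q hq e
    rw [ContinuousLinearMap.adjoint_inner_left]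
    simp only [ContinuousLinearMap.comp_apply, metricCoord_apply, hq]

end Metric

end Smoothness

/-! ### The pullback connection: metric compatibility, parallel `J`, symmetry of the second
fundamental form. -/

section Pullback

variable {E : Type*} [NormedAddCommGroup E] [NormedSpace ℝ E] [FiniteDimensional ℝ E]
  {M : Type*} [TopologicalSpace M] [ChartedSpace E M] [IsManifold 𝓘(ℝ, E) ∞ M]
  {E' : Type*} [NormedAddCommGroup E'] [NormedSpace ℝ E'] [FiniteDimensional ℝ E']
  {N : Type*} [TopologicalSpace N] [ChartedSpace E' N] [IsManifold 𝓘(ℝ, E') ∞ N]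

theorem toCoord_self (x : M) (v : TangentSpace 𝓘(ℝ, E) x) : toCoord x x v = v := by
  unfold toCoord
  rw [Trivialization.continuousLinearMapAt_apply, Trivialization.coe_linearMapAt_of_mem _
    (FiberBundle.mem_baseSet_trivializationAt' x)]
  exact tangentCoordChange_self (mem_extChartAt_source x)

theorem mvfderiv_comp_apply {W : Type*} [NormedAddCommGroup W] [NormedSpace ℝ W] {F : M → N}
    {u : N → W} {p : M} (hu : MDifferentiableAt 𝓘(ℝ, E') 𝓘(ℝ, W) u (F p))
    (hF : MDifferentiableAt 𝓘(ℝ, E) 𝓘(ℝ, E') F p) (v : TangentSpace 𝓘(ℝ, E) p) :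
    mvfderiv 𝓘(ℝ, E) (fun q => u (F q)) p v
      = mvfderiv 𝓘(ℝ, E') u (F p) (differential E E' F p v) :=
  DFunLike.congr_fun (mfderiv_comp (I'' := 𝓘(ℝ, W)) (g := u) p hu hF) v

theorem mvfderiv_clm_apply {W : Type*} [NormedAddCommGroup W] [NormedSpace ℝ W]
    {G : M → (W →L[ℝ] W)} {s : M → W} {x : M}
    (hG : MDifferentiableAt 𝓘(ℝ, E) 𝓘(ℝ, W →L[ℝ] W) G x)
    (hs : MDifferentiableAt 𝓘(ℝ, E) 𝓘(ℝ, W) s x) (v : TangentSpace 𝓘(ℝ, E) x) :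
    mvfderiv 𝓘(ℝ, E) (fun y => G y (s y)) x v
      = mvfderiv 𝓘(ℝ, E) G x v (s x) + G x (mvfderiv 𝓘(ℝ, E) s x v) := by
  have h1 := (differentiableAt_chart hG).hasFDerivAt.clm_apply
    (differentiableAt_chart hs).hasFDerivAt
  have hx : (extChartAt 𝓘(ℝ, E) x).symm (extChartAt 𝓘(ℝ, E) x x) = x := extChartAt_to_inv x
  rw [mvfderiv_eq_fderiv (hG.clm_apply hs), mvfderiv_eq_fderiv hG, mvfderiv_eq_fderiv hs]
  refine (DFunLike.congr_fun h1.fderiv (v : E)).trans ?_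
  simp only [Function.comp_apply, hx]
  set φ := extChartAt 𝓘(ℝ, E) x
  change G x (fderiv ℝ (s ∘ φ.symm) (φ x) (v : E))
      + fderiv ℝ (G ∘ φ.symm) (φ x) (v : E) (s x) = _
  exact add_comm _ _

/-- A `(1,1)`-tensor field at `y`, written in the coordinate frame of the chart at `x`. -/
def tensorCoord (J : Π y : M, TangentSpace 𝓘(ℝ, E) y →L[ℝ] TangentSpace 𝓘(ℝ, E) y) (x y : M) :
    E →L[ℝ] E :=
  toCoord x y ∘L J y ∘L ofCoord x y

theorem contMDiffAt_tensorCoord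
    {J : Π y : M, TangentSpace 𝓘(ℝ, E) y →L[ℝ] TangentSpace 𝓘(ℝ, E) y}
    (hJ : ContMDiff 𝓘(ℝ, E) (𝓘(ℝ, E).prod 𝓘(ℝ, E →L[ℝ] E)) ∞
      (fun y => TotalSpace.mk' (E →L[ℝ] E)
        (E := fun y : M => TangentSpace 𝓘(ℝ, E) y →L[ℝ] TangentSpace 𝓘(ℝ, E) y) y (J y))) (x : M) :
    ContMDiffAt 𝓘(ℝ, E) 𝓘(ℝ, E →L[ℝ] E) ∞ (tensorCoord J x) x :=
  ((contMDiffAt_hom_bundle _).1 (hJ x)).2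

/-- The identity is needed on a neighbourhood, not only at the centre, since it is differentiated
once more in `secondFundamentalForm_comm`. -/
theorem fderiv_chart_eventually {F : M → N} (hF : ContMDiff 𝓘(ℝ, E) 𝓘(ℝ, E') ∞ F) (p : M) :
    ∀ᶠ z in nhds (extChartAt 𝓘(ℝ, E) p p),
      toCoord (F p) (F ((extChartAt 𝓘(ℝ, E) p).symm z))
          ∘L differential E E' F ((extChartAt 𝓘(ℝ, E) p).symm z)
          ∘L ofCoord p ((extChartAt 𝓘(ℝ, E) p).symm z)
        = fderiv ℝ (extChartAt 𝓘(ℝ, E') (F p) ∘ F ∘ (extChartAt 𝓘(ℝ, E) p).symm) z := by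
  have hc : ContinuousAt (fun z => F ((extChartAt 𝓘(ℝ, E) p).symm z)) (extChartAt 𝓘(ℝ, E) p p) :=
    hF.continuous.continuousAt.comp (continuousAt_extChartAt_symm p)
  have hF' : F ((extChartAt 𝓘(ℝ, E) p).symm (extChartAt 𝓘(ℝ, E) p p)) = F p := by
    rw [extChartAt_to_inv]
  filter_upwards [extChartAt_target_mem_nhds (I := 𝓘(ℝ, E)) p,
    hc.preimage_mem_nhds ((chartAt E' (F p)).open_source.mem_nhds
      (by rw [hF']; exact mem_chart_source E' (F p)))] with z hz hz'
  have hy : (extChartAt 𝓘(ℝ, E) p).symm z ∈ (chartAt E p).source := by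
    simpa using (extChartAt 𝓘(ℝ, E) p).map_target hz
  refine (inTangentCoordinates_eq_mfderiv_comp (I := 𝓘(ℝ, E)) (I' := 𝓘(ℝ, E'))
    (f := fun q : M => q) (g := F)
    (ϕ := fun q => differential E E' F q) (x₀ := p) hy hz').trans ?_
  rw [(extChartAt 𝓘(ℝ, E) p).right_inv hz]
  have h0 : MDifferentiableAt 𝓘(ℝ, E) 𝓘(ℝ, E) (extChartAt 𝓘(ℝ, E) p).symm z :=
    (mdifferentiableWithinAt_extChartAt_symm hz).mdifferentiableAt (by simp)
  have h1 := h0.hasMFDerivAt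
  have h2 := (hF.mdifferentiableAt (by simp)
    (x := (extChartAt 𝓘(ℝ, E) p).symm z)).hasMFDerivAt
  have h3 := (mdifferentiableAt_extChartAt (I := 𝓘(ℝ, E')) hz').hasMFDerivAt
  refine Eq.trans ?_ ((h3.comp z (h2.comp z h1)).mfderiv.symm.trans mfderiv_eq_fderiv)
  simp only [modelWithCornersSelf_coe, Set.range_id, mfderivWithin_univ]
  rfl

section Metric
variable [RiemannianBundle (fun x : M => TangentSpace 𝓘(ℝ, E) x)]
  [RiemannianBundle (fun x : N => TangentSpace 𝓘(ℝ, E') x)]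
  [IsContMDiffRiemannianBundle 𝓘(ℝ, E) ∞ E (fun x : M => TangentSpace 𝓘(ℝ, E) x)]
  [IsContMDiffRiemannianBundle 𝓘(ℝ, E') ∞ E' (fun x : N => TangentSpace 𝓘(ℝ, E') x)]

/-- Metric compatibility at the level of Christoffel symbols; it no longer involves vector fields,
so it can be evaluated along a map. -/
theorem metricDeriv_eq (x : M) (v w z : TangentSpace 𝓘(ℝ, E) x) :
    metricDeriv x v w z = inner ℝ (christoffel x w v) z + inner ℝ w (christoffel x z v) := by
  rw [real_inner_comm _ w, inner_christoffel, inner_christoffel, metricDeriv_comm x v z w,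
    metricDeriv_comm x z v w, metricDeriv_comm x w v z]
  ring

theorem christoffel_comm (x : M) (v w : TangentSpace 𝓘(ℝ, E) x) :
    christoffel x w v = christoffel x v w := by
  refine ext_inner_right ℝ fun z => ?_
  rw [inner_christoffel, inner_christoffel, metricDeriv_comm x z w v]
  ring

theorem mvfderiv_inner_along {F : M → N} {V W : Π q : M, TangentSpace 𝓘(ℝ, E') (F q)} {p : M}
    (hV : MDifferentiableAt 𝓘(ℝ, E) (𝓘(ℝ, E').prod 𝓘(ℝ, E'))
      (fun q => (⟨F q, V q⟩ : TangentBundle 𝓘(ℝ, E') N)) p)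
    (hW : MDifferentiableAt 𝓘(ℝ, E) (𝓘(ℝ, E').prod 𝓘(ℝ, E'))
      (fun q => (⟨F q, W q⟩ : TangentBundle 𝓘(ℝ, E') N)) p) (v : TangentSpace 𝓘(ℝ, E) p) :
    mvfderiv 𝓘(ℝ, E) (fun q => inner ℝ (V q) (W q)) p v
      = inner ℝ (pullbackCov E E' F V p v) (W p) + inner ℝ (V p) (pullbackCov E E' F W p v) := by
  have hF : MDifferentiableAt 𝓘(ℝ, E) 𝓘(ℝ, E') F p := ((mdifferentiableAt_totalSpace _ _).1 hV).1
  have h : (fun q => inner ℝ (V q) (W q)) =ᶠ[nhds p] fun q =>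
      metricCoord (F p) (F q) (toCoord (F p) (F q) (V q)) (toCoord (F p) (F q) (W q)) := by
    filter_upwards [hF.continuousAt.eventually (ofCoord_toCoord_eventually (E := E') (F p))]
      with q hq
    simp [metricCoord, hq]
  have h1 : mvfderiv 𝓘(ℝ, E) (fun q => inner ℝ (V q) (W q)) p = mvfderiv 𝓘(ℝ, E) (fun q =>
      metricCoord (F p) (F q) (toCoord (F p) (F q) (V q)) (toCoord (F p) (F q) (W q))) p := by
    rw [mvfderiv, mvfderiv, h.mfderiv_eq]; rfl
  have hG := mdifferentiableAt_metricCoord (E := E') (F p)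
  rw [h1, mvfderiv_clm_apply₂ (G := fun q => metricCoord (F p) (F q)) (hG.comp p hF)
    (mdifferentiableAt_toCoord_along hV) (mdifferentiableAt_toCoord_along hW),
    mvfderiv_comp_apply hG hF]
  have e (U : Π q : M, TangentSpace 𝓘(ℝ, E') (F q)) : pullbackCov E E' F U p v
      = ofCoord (F p) (F p) (mvfderiv 𝓘(ℝ, E) (fun q => toCoord (F p) (F q) (U q)) p v)
        + christoffel (F p) (U p) (differential E E' F p v) := rfl
  have h2 := metricDeriv_eq (F p) (differential E E' F p v) (V p) (W p)
  unfold metricDeriv at h2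
  rw [e, e, inner_add_left, inner_add_right, h2]
  simp only [metricCoord_apply, ofCoord_toCoord]
  ring

theorem mvfderiv_toCoord_tensor
    {J : Π y : N, TangentSpace 𝓘(ℝ, E') y →L[ℝ] TangentSpace 𝓘(ℝ, E') y}
    (hJ : ContMDiff 𝓘(ℝ, E') (𝓘(ℝ, E').prod 𝓘(ℝ, E' →L[ℝ] E')) ∞
      (fun y => TotalSpace.mk' (E' →L[ℝ] E')
        (E := fun y : N => TangentSpace 𝓘(ℝ, E') y →L[ℝ] TangentSpace 𝓘(ℝ, E') y) y (J y)))
    {F : M → N} {V : Π q : M, TangentSpace 𝓘(ℝ, E') (F q)} {p : M}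
    (hV : MDifferentiableAt 𝓘(ℝ, E) (𝓘(ℝ, E').prod 𝓘(ℝ, E'))
      (fun q => (⟨F q, V q⟩ : TangentBundle 𝓘(ℝ, E') N)) p) (v : TangentSpace 𝓘(ℝ, E) p) :
    ofCoord (F p) (F p) (mvfderiv 𝓘(ℝ, E) (fun q => toCoord (F p) (F q) (J (F q) (V q))) p v)
      = ofCoord (F p) (F p) (mvfderiv 𝓘(ℝ, E') (tensorCoord J (F p)) (F p)
          (differential E E' F p v) (toCoord (F p) (F p) (V p)))
        + J (F p) (ofCoord (F p) (F p)
          (mvfderiv 𝓘(ℝ, E) (fun q => toCoord (F p) (F q) (V q)) p v)) := by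
  have hF : MDifferentiableAt 𝓘(ℝ, E) 𝓘(ℝ, E') F p := ((mdifferentiableAt_totalSpace _ _).1 hV).1
  have hJ' := (contMDiffAt_tensorCoord hJ (F p)).mdifferentiableAt (by simp)
  have h : (fun q => toCoord (F p) (F q) (J (F q) (V q)))
      =ᶠ[nhds p] fun q => tensorCoord J (F p) (F q) (toCoord (F p) (F q) (V q)) := by
    filter_upwards [hF.continuousAt.eventually (ofCoord_toCoord_eventually (E := E') (F p))]
      with q hq
    simp [tensorCoord, hq]
  have h1 : mvfderiv 𝓘(ℝ, E) (fun q => toCoord (F p) (F q) (J (F q) (V q))) p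
      = mvfderiv 𝓘(ℝ, E) (fun q => tensorCoord J (F p) (F q) (toCoord (F p) (F q) (V q))) p := by
    rw [mvfderiv, mvfderiv, h.mfderiv_eq]; rfl
  rw [h1, mvfderiv_clm_apply (G := fun q => tensorCoord J (F p) (F q)) (hJ'.comp p hF)
    (mdifferentiableAt_toCoord_along hV), mvfderiv_comp_apply hJ' hF, map_add]
  simp only [tensorCoord, ContinuousLinearMap.comp_apply, ofCoord_toCoord]

/-- A field along `F` need not come from a field on `N`. But in coordinates `∇J` is the derivative
of the matrix of `J` plus Christoffel terms, depending only on the values of the two fields at the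
point. Its vanishing is read off from arbitrary smooth extensions of `F_* v` and `V p`. -/
theorem IsKahler.pullbackCov_apply [T2Space N]
    {J : Π y : N, TangentSpace 𝓘(ℝ, E') y →L[ℝ] TangentSpace 𝓘(ℝ, E') y} (hJ : IsKahler J)
    {F : M → N} {V : Π q : M, TangentSpace 𝓘(ℝ, E') (F q)} {p : M}
    (hV : MDifferentiableAt 𝓘(ℝ, E) (𝓘(ℝ, E').prod 𝓘(ℝ, E'))
      (fun q => (⟨F q, V q⟩ : TangentBundle 𝓘(ℝ, E') N)) p) (v : TangentSpace 𝓘(ℝ, E) p) :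
    pullbackCov E E' F (fun q => J (F q) (V q)) p v = J (F p) (pullbackCov E E' F V p v) := by
  obtain ⟨X, hX, hXp⟩ := exists_isSmoothField_eq (differential E E' F p v)
  obtain ⟨Y, hY, hYp⟩ := exists_isSmoothField_eq (V p)
  have key := hJ.parallel X Y hX hY (F p)
  -- Along the identity map, the Leibniz rule for fields along a map becomes the one for fields on
  -- `N`.
  have h1 := mvfderiv_toCoord_tensor hJ.smooth (F := fun y : N => y)
    (hY.mdifferentiableAt (F p)) (X (F p))
  have hid : differential E' E' (fun y : N => y) (F p) (X (F p)) = X (F p) := by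
    unfold differential
    exact DFunLike.congr_fun (mfderiv_id (I := 𝓘(ℝ, E')) (x := F p)) _
  rw [hid] at h1
  change ofCoord (F p) (F p) (mvfderiv 𝓘(ℝ, E') (fun y => toCoord (F p) y (J y (Y y))) (F p)
      (X (F p))) + christoffel (F p) (J (F p) (Y (F p))) (X (F p))
    - J (F p) (ofCoord (F p) (F p) (mvfderiv 𝓘(ℝ, E') (fun y => toCoord (F p) y (Y y)) (F p)
      (X (F p))) + christoffel (F p) (Y (F p)) (X (F p))) = 0 at key
  rw [h1, hXp, hYp, map_add] at key
  change ofCoord (F p) (F p) (mvfderiv 𝓘(ℝ, E) (fun q => toCoord (F p) (F q) (J (F q) (V q))) p v)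
      + christoffel (F p) (J (F p) (V p)) (differential E E' F p v)
    = J (F p) (ofCoord (F p) (F p) (mvfderiv 𝓘(ℝ, E) (fun q => toCoord (F p) (F q) (V q)) p v)
      + christoffel (F p) (V p) (differential E E' F p v))
  rw [mvfderiv_toCoord_tensor hJ.smooth hV, map_add, ← sub_eq_zero, ← key]
  abel

/-- In coordinates the form is `D²f(v, w) + Γ₂(F_* v, F_* w) - F_* Γ₁(v, w)`, and each term is
symmetric. -/
theorem secondFundamentalForm_comm {F : M → N} (hF : ContMDiff 𝓘(ℝ, E) 𝓘(ℝ, E') ∞ F) (p : M)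
    (v w : TangentSpace 𝓘(ℝ, E) p) :
    secondFundamentalForm E E' F p v w = secondFundamentalForm E E' F p w v := by
  set f := extChartAt 𝓘(ℝ, E') (F p) ∘ F ∘ (extChartAt 𝓘(ℝ, E) p).symm with hf
  have hsmooth : ContDiffAt ℝ ∞ f (extChartAt 𝓘(ℝ, E) p p) := by
    have h := (contMDiffAt_iff.1 (hF.contMDiffAt (x := p))).2
    simpa only [modelWithCornersSelf_coe, Set.range_id, contDiffWithinAt_univ] using h
  have hd (v w : TangentSpace 𝓘(ℝ, E) p) : mvfderiv 𝓘(ℝ, E) (fun q =>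
      toCoord (F p) (F q) (differential E E' F q (FiberBundle.extend E w q))) p v
      = fderiv ℝ (fderiv ℝ f) (extChartAt 𝓘(ℝ, E) p p) v w := by
    have hmd : MDifferentiableAt 𝓘(ℝ, E) (𝓘(ℝ, E').prod 𝓘(ℝ, E')) (fun q =>
        (⟨F q, differential E E' F q (FiberBundle.extend E w q)⟩ : TangentBundle 𝓘(ℝ, E') N)) p :=
      (((hF.contMDiff_tangentMap (m := 1) (by norm_cast)).contMDiffAt
        (x := (⟨p, FiberBundle.extend E w p⟩ : TangentBundle 𝓘(ℝ, E) M))).mdifferentiableAt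
          (by simp)).comp p (FiberBundle.mdifferentiableAt_extend ..)
    rw [mvfderiv_eq_fderiv (mdifferentiableAt_toCoord_along hmd)]
    -- The extension of `w` has constant coordinates, so the coordinates of its image under `F_*`
    -- are `Df(z) w` near the centre.
    have hev : ((fun q => toCoord (F p) (F q) (differential E E' F q (FiberBundle.extend E w q)))
        ∘ (extChartAt 𝓘(ℝ, E) p).symm) =ᶠ[nhds (extChartAt 𝓘(ℝ, E) p p)]
        fun z => fderiv ℝ f z w := by
      have ht := continuousAt_extChartAt_symm (I := 𝓘(ℝ, E)) p
      rw [ContinuousAt, extChartAt_to_inv] at ht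
      filter_upwards [fderiv_chart_eventually hF p, ht.eventually (toCoord_extend_eventually p w),
        ht.eventually (ofCoord_toCoord_eventually (E := E) p)] with z h1 h2 h3
      rw [toCoord_self] at h2
      rw [← h1]
      simp only [Function.comp_apply]
      rw [← h3 (FiberBundle.extend E w _), h2]
      rfl
    rw [hev.fderiv_eq]
    have h2 : DifferentiableAt ℝ (fderiv ℝ f) (extChartAt 𝓘(ℝ, E) p p) :=
      (hsmooth.fderiv_right (m := 1) (by norm_cast)).differentiableAt (by simp)
    have h3 := h2.hasFDerivAt.clm_apply (hasFDerivAt_const (w : E) (extChartAt 𝓘(ℝ, E) p p))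
    have aux (A : E →L[ℝ] E') (B : E →L[ℝ] E →L[ℝ] E') (v w : E) :
        (A ∘L (0 : E →L[ℝ] E) + B.flip w) v = B v w := by simp
    rw [h3.fderiv]
    exact aux _ _ _ _
  have hsymm := (hsmooth.isSymmSndFDerivAt (by simp; norm_cast)).eq (v : E) (w : E)
  have e (v w : TangentSpace 𝓘(ℝ, E) p) : secondFundamentalForm E E' F p v w
      = ofCoord (F p) (F p) (mvfderiv 𝓘(ℝ, E) (fun q =>
        toCoord (F p) (F q) (differential E E' F q (FiberBundle.extend E w q))) p v)
      + christoffel (F p) (differential E E' F p (FiberBundle.extend E w p))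
          (differential E E' F p v)
      - differential E E' F p (leviCivita (FiberBundle.extend E w) p v) := rfl
  rw [e, e, hd, hd, leviCivita_extend, leviCivita_extend, christoffel_comm p]
  simp only [FiberBundle.extend_apply_self]
  rw [christoffel_comm (F p)]
  exact congrArg (fun x => ofCoord (F p) (F p) x + _ - _) hsymm

end Metric

end Pullback

/-! ### Second fundamental form of a Riemannian map. -/

section RiemannianMaps

variable {E : Type*} [NormedAddCommGroup E] [NormedSpace ℝ E] [FiniteDimensional ℝ E]
  {M : Type*} [TopologicalSpace M] [ChartedSpace E M] [IsManifold 𝓘(ℝ, E) ∞ M]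
  {E' : Type*} [NormedAddCommGroup E'] [NormedSpace ℝ E'] [FiniteDimensional ℝ E']
  {N : Type*} [TopologicalSpace N] [ChartedSpace E' N] [IsManifold 𝓘(ℝ, E') ∞ N]
  [RiemannianBundle (fun x : M => TangentSpace 𝓘(ℝ, E) x)]
  [RiemannianBundle (fun x : N => TangentSpace 𝓘(ℝ, E') x)]
  [IsContMDiffRiemannianBundle 𝓘(ℝ, E) ∞ E (fun x : M => TangentSpace 𝓘(ℝ, E) x)]
  [IsContMDiffRiemannianBundle 𝓘(ℝ, E') ∞ E' (fun x : N => TangentSpace 𝓘(ℝ, E') x)]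
  {F : M → N}

/-- The second fundamental form as a bilinear map. -/
def secondFundamentalFormBilin (hF : ContMDiff 𝓘(ℝ, E) 𝓘(ℝ, E') ∞ F) (p : M) :
    TangentSpace 𝓘(ℝ, E) p →ₗ[ℝ] TangentSpace 𝓘(ℝ, E) p →ₗ[ℝ] TangentSpace 𝓘(ℝ, E') (F p) :=
  have add (v v' w : TangentSpace 𝓘(ℝ, E) p) : secondFundamentalForm E E' F p (v + v') w
      = secondFundamentalForm E E' F p v w + secondFundamentalForm E E' F p v' w := by
    simp only [secondFundamentalForm, map_add]
    abel
  have smul (c : ℝ) (v w : TangentSpace 𝓘(ℝ, E) p) : secondFundamentalForm E E' F p (c • v) w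
      = c • secondFundamentalForm E E' F p v w := by
    simp only [secondFundamentalForm, map_smul, smul_sub]
  LinearMap.mk₂ ℝ (secondFundamentalForm E E' F p) add smul
    (fun v w w' => by
      rw [secondFundamentalForm_comm hF, add, secondFundamentalForm_comm hF p w,
        secondFundamentalForm_comm hF p w'])
    (fun c v w => by
      rw [secondFundamentalForm_comm hF, smul, secondFundamentalForm_comm hF p w])

theorem secondFundamentalFormBilin_apply (hF : ContMDiff 𝓘(ℝ, E) 𝓘(ℝ, E') ∞ F) (p : M)
    (v w : TangentSpace 𝓘(ℝ, E) p) :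
    secondFundamentalFormBilin hF p v w = secondFundamentalForm E E' F p v w := rfl

/-- The field `A† A X` is the horizontal projection of `X`. Its smoothness comes from that of the
adjoint, with no need for a local frame of `ker F_*` or an argument about its rank. -/
theorem IsRiemannianMap.isSmoothField_horizontal (hF : IsRiemannianMap E E' F)
    {X : Π q : M, TangentSpace 𝓘(ℝ, E) q} (hX : IsSmoothField X) :
    IsSmoothField (fun q => (differential E E' F q).adjoint (differential E E' F q (X q))) :=
  isSmoothField_adjoint hF.smooth (contMDiff_differential_apply hF.smooth hX)

theorem IsRiemannianMap.exists_horizontal_field [T2Space M] (hF : IsRiemannianMap E E' F) {p : M}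
    {v : TangentSpace 𝓘(ℝ, E) p} (hv : v ∈ horizontalAt E E' F p) :
    ∃ X : Π q : M, TangentSpace 𝓘(ℝ, E) q,
      IsSmoothField X ∧ (∀ q, X q ∈ horizontalAt E E' F q) ∧ X p = v := by
  obtain ⟨X, hX, rfl⟩ := exists_isSmoothField_eq v
  exact ⟨_, hF.isSmoothField_horizontal hX, fun q => adjoint_mem_ker_orthogonal _ _,
    adjoint_apply_apply_of_mem (hF.isometric p) hv⟩

theorem IsRiemannianMap.exists_vertical_field [T2Space M] (hF : IsRiemannianMap E E' F) {p : M}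
    {v : TangentSpace 𝓘(ℝ, E) p} (hv : v ∈ kerAt E E' F p) :
    ∃ X : Π q : M, TangentSpace 𝓘(ℝ, E) q,
      IsSmoothField X ∧ (∀ q, X q ∈ kerAt E E' F q) ∧ X p = v := by
  obtain ⟨X, hX, rfl⟩ := exists_isSmoothField_eq v
  have hv' : differential E E' F p (X p) = 0 := hv
  refine ⟨_, hX.sub (hF.isSmoothField_horizontal hX), fun q => ?_, ?_⟩
  · change differential E E' F q (X q - _) = 0
    rw [map_sub, apply_adjoint_apply (hF.isometric q)]
    exact sub_eq_zero.2 (Submodule.starProjection_eq_self_iff.2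
      (LinearMap.mem_range_self (differential E E' F q).toLinearMap (X q))).symm
  · rw [hv', map_zero, sub_zero]

/-- Differentiate `⟪F_* X, F_* Y⟫ = ⟪X, Y⟫` for horizontal `X`, `Y`, using metric compatibility of
both connections. -/
theorem IsRiemannianMap.inner_secondFundamentalForm_add (hF : IsRiemannianMap E E' F) [T2Space M]
    {p : M} (v : TangentSpace 𝓘(ℝ, E) p) {w z : TangentSpace 𝓘(ℝ, E) p}
    (hw : w ∈ horizontalAt E E' F p) (hz : z ∈ horizontalAt E E' F p) :
    inner ℝ (secondFundamentalForm E E' F p v w) (differential E E' F p z)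
      + inner ℝ (differential E E' F p w) (secondFundamentalForm E E' F p v z) = 0 := by
  obtain ⟨X, hX, hXH, rfl⟩ := hF.exists_horizontal_field hw
  obtain ⟨Y, hY, hYH, rfl⟩ := hF.exists_horizontal_field hz
  have h (X : Π q : M, TangentSpace 𝓘(ℝ, E) q) (hX : IsSmoothField X) :=
    ((contMDiff_differential_apply hF.smooth hX) p).mdifferentiableAt (by simp)
  have h1 := mvfderiv_inner_along (h X hX) (h Y hY) v
  have h2 := leviCivita_metric (hX.mdifferentiableAt p) (hY.mdifferentiableAt p) v
  have h3 : (fun q => inner ℝ (differential E E' F q (X q)) (differential E E' F q (Y q)))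
      = fun q => inner ℝ (X q) (Y q) :=
    funext fun q => hF.isometric q _ (hXH q) _ (hYH q)
  rw [h3, h2] at h1
  rw [secondFundamentalForm_eq hF.smooth (hX.mdifferentiableAt p),
    secondFundamentalForm_eq hF.smooth (hY.mdifferentiableAt p), inner_sub_left, inner_sub_right,
    inner_map_map_of_mem (hF.isometric p) _ hz,
    real_inner_comm (differential E E' F p (leviCivita Y p v)),
    inner_map_map_of_mem (hF.isometric p) _ hw, real_inner_comm (X p)]
  linarith

/-- The trilinear form `⟪B(v, w), F_* z⟫` on `H` is symmetric in `v, w` and skew in `w, z`, hence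
zero. -/
theorem IsRiemannianMap.inner_secondFundamentalForm_eq_zero (hF : IsRiemannianMap E E' F)
    [T2Space M] {p : M} {v w z : TangentSpace 𝓘(ℝ, E) p} (hv : v ∈ horizontalAt E E' F p)
    (hw : w ∈ horizontalAt E E' F p) (hz : z ∈ horizontalAt E E' F p) :
    inner ℝ (secondFundamentalForm E E' F p v w) (differential E E' F p z) = 0 := by
  have h1 := hF.inner_secondFundamentalForm_add v hw hz
  have h2 := hF.inner_secondFundamentalForm_add w hz hv
  have h3 := hF.inner_secondFundamentalForm_add z hv hw
  rw [real_inner_comm] at h1 h2 h3 ⊢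
  rw [secondFundamentalForm_comm hF.smooth p w z, secondFundamentalForm_comm hF.smooth p w v] at h2
  rw [secondFundamentalForm_comm hF.smooth p z v] at h3
  linarith

theorem IsRiemannianMap.secondFundamentalForm_mem (hF : IsRiemannianMap E E' F)
    [T2Space M] {p : M} {v w : TangentSpace 𝓘(ℝ, E) p} (hv : v ∈ horizontalAt E E' F p)
    (hw : w ∈ horizontalAt E E' F p) :
    secondFundamentalForm E E' F p v w ∈ (rangeAt E E' F p)ᗮ := by
  rw [Submodule.mem_orthogonal']
  rintro _ ⟨z, rfl⟩
  change inner ℝ _ (differential E E' F p z) = 0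
  rw [apply_eq_apply_starProjection]
  exact hF.inner_secondFundamentalForm_eq_zero hv hw (Submodule.starProjection_apply_mem _ _)

theorem secondFundamentalForm_eq_of_vertical (hF : ContMDiff 𝓘(ℝ, E) 𝓘(ℝ, E') ∞ F)
    {X : Π q : M, TangentSpace 𝓘(ℝ, E) q} (hX : IsSmoothField X)
    (hXV : ∀ q, X q ∈ kerAt E E' F q) (p : M) (v : TangentSpace 𝓘(ℝ, E) p) :
    secondFundamentalForm E E' F p v (X p)
      = - differential E E' F p ((kerAt E E' F p)ᗮ.starProjection (leviCivita X p v)) := by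
  have h (q : M) : differential E E' F q (X q) = 0 := hXV q
  rw [secondFundamentalForm_eq hF (hX.mdifferentiableAt p),
    apply_eq_apply_starProjection (differential E E' F p) (leviCivita X p v)]
  have h0 : pullbackCov E E' F (fun q => differential E E' F q (X q)) p v = 0 := by
    simp only [h]
    have h1 : (fun q => toCoord (F p) (F q) (0 : TangentSpace 𝓘(ℝ, E') (F q))) = fun _ => 0 := by
      funext q; exact map_zero _
    have hc : christoffel (F p) (0 : TangentSpace 𝓘(ℝ, E') (F p)) = 0 := by
      simpa using christoffel_smul (F p) 0 (0 : TangentSpace 𝓘(ℝ, E') (F p))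
    unfold pullbackCov
    rw [h1, mvfderiv_const, hc]
    simp
  rw [h0, zero_sub]
  rfl

theorem IsOmegaParallel.secondFundamentalForm_adjoint [T2Space M] [T2Space N]
    {J : Π y : N, TangentSpace 𝓘(ℝ, E') y →L[ℝ] TangentSpace 𝓘(ℝ, E') y} (hJ : IsKahler J)
    (hω : IsOmegaParallel E E' F J) (hF : IsRiemannianMap E E' F) {p : M}
    {v w : TangentSpace 𝓘(ℝ, E) p} (hv : v ∈ horizontalAt E E' F p)
    (hw : w ∈ horizontalAt E E' F p) :
    secondFundamentalForm E E' F p v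
        ((differential E E' F p).adjoint (J (F p) (differential E E' F p w)))
      = (rangeAt E E' F p)ᗮ.starProjection (J (F p) (secondFundamentalForm E E' F p v w)) := by
  obtain ⟨X, hX, hXH, rfl⟩ := hF.exists_horizontal_field hv
  obtain ⟨Y, hY, hYH, rfl⟩ := hF.exists_horizontal_field hw
  have hAY := contMDiff_differential_apply hF.smooth hY
  have hJAY : ContMDiff 𝓘(ℝ, E) (𝓘(ℝ, E').prod 𝓘(ℝ, E')) ∞
      (fun q => (⟨F q, J (F q) (differential E E' F q (Y q))⟩ : TangentBundle 𝓘(ℝ, E') N)) :=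
    fun q => ContMDiffAt.clm_bundle_apply ((hJ.smooth.comp hF.smooth) q) (hAY q)
  have hQ := isSmoothField_adjoint hF.smooth hJAY
  have hAQ := contMDiff_differential_apply hF.smooth hQ
  have hmd {V : Π q : M, TangentSpace 𝓘(ℝ, E') (F q)}
      (hV : ContMDiff 𝓘(ℝ, E) (𝓘(ℝ, E').prod 𝓘(ℝ, E')) ∞
        (fun q => (⟨F q, V q⟩ : TangentBundle 𝓘(ℝ, E') N))) := (hV p).mdifferentiableAt (by simp)
  -- Tangential and normal parts of `J F_* Y`, the tangential one written as `F_* Q Y` with `Q Y` a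
  -- smooth horizontal field.
  have hsplit (q : M) : J (F q) (differential E E' F q (Y q))
      = differential E E' F q ((differential E E' F q).adjoint
          (J (F q) (differential E E' F q (Y q))))
        + omega E E' F J q (differential E E' F q (Y q)) := by
    rw [apply_adjoint_apply (hF.isometric q)]
    exact ((rangeAt E E' F q).starProjection_add_starProjection_orthogonal _).symm
  have hωY : MDifferentiableAt 𝓘(ℝ, E) (𝓘(ℝ, E').prod 𝓘(ℝ, E'))
      (fun q => (⟨F q, omega E E' F J q (differential E E' F q (Y q))⟩ :
        TangentBundle 𝓘(ℝ, E') N)) p := by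
    have e (q : M) : omega E E' F J q (differential E E' F q (Y q))
        = J (F q) (differential E E' F q (Y q)) - differential E E' F q
          ((differential E E' F q).adjoint (J (F q) (differential E E' F q (Y q)))) :=
      eq_sub_of_add_eq' (hsplit q).symm
    simp only [e]
    refine ContMDiffAt.mdifferentiableAt (n := ∞) (contMDiffAt_along_iff.2
      ⟨hF.smooth p, ?_⟩) (by simp)
    simpa only [map_sub] using
      (contMDiffAt_along_iff.1 (hJAY p)).2.sub (contMDiffAt_along_iff.1 (hAQ p)).2
  have h1 := hJ.pullbackCov_apply (hmd hAY) (X p)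
  have h2 := DFunLike.congr_fun (pullbackCov_add (hmd hAQ) hωY) (X p)
  simp only [← hsplit] at h2
  rw [h1, add_apply] at h2
  have h3 := sub_eq_zero.1 (hω X Y hX hY hXH hYH p)
  unfold normalCov omega at h3
  have h4 := secondFundamentalForm_eq hF.smooth (hQ.mdifferentiableAt p) (X p)
  have h5 := secondFundamentalForm_eq hF.smooth (hY.mdifferentiableAt p) (X p)
  have hmem : secondFundamentalForm E E' F p (X p)
      ((differential E E' F p).adjoint (J (F p) (differential E E' F p (Y p))))
      ∈ (rangeAt E E' F p)ᗮ := hF.secondFundamentalForm_mem hv (adjoint_mem_ker_orthogonal _ _)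
  have h6 (z : TangentSpace 𝓘(ℝ, E) p) :
      (rangeAt E E' F p)ᗮ.starProjection (differential E E' F p z) = 0 := by
    rw [Submodule.starProjection_apply_eq_zero_iff]
    exact Submodule.le_orthogonal_orthogonal _ ⟨z, rfl⟩
  -- In normal parts, `∇^F (F_* Q Y)` contributes `B(X, Q Y)` alone, and the two terms `ω F_*(∇_X
  -- Y)` cancel by `h3`.
  have h7 := congrArg (rangeAt E E' F p)ᗮ.starProjection h2
  have h8 := congrArg (rangeAt E E' F p)ᗮ.starProjection h4
  rw [Submodule.starProjection_eq_self_iff.2 hmem, map_sub, h6, sub_zero] at h8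
  rw [map_add, ← h8] at h7
  rw [h5, map_sub, map_sub, h7]
  unfold omega
  rw [h3]
  abel

end RiemannianMaps

/-! ### Tension field versus mean curvature of the vertical distribution. -/

section Harmonic

variable {E : Type*} [NormedAddCommGroup E] [NormedSpace ℝ E] [FiniteDimensional ℝ E]
  {M : Type*} [TopologicalSpace M] [ChartedSpace E M] [IsManifold 𝓘(ℝ, E) ∞ M]
  {E' : Type*} [NormedAddCommGroup E'] [NormedSpace ℝ E'] [FiniteDimensional ℝ E']
  {N : Type*} [TopologicalSpace N] [ChartedSpace E' N] [IsManifold 𝓘(ℝ, E') ∞ N]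
  [RiemannianBundle (fun x : M => TangentSpace 𝓘(ℝ, E) x)]
  [RiemannianBundle (fun x : N => TangentSpace 𝓘(ℝ, E') x)]
  [IsContMDiffRiemannianBundle 𝓘(ℝ, E) ∞ E (fun x : M => TangentSpace 𝓘(ℝ, E) x)]
  [IsContMDiffRiemannianBundle 𝓘(ℝ, E') ∞ E' (fun x : N => TangentSpace 𝓘(ℝ, E') x)]
  [T2Space M] [T2Space N] {F : M → N} {θ : ℝ}
  {J : Π y : N, TangentSpace 𝓘(ℝ, E') y →L[ℝ] TangentSpace 𝓘(ℝ, E') y}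

/-- The tension field is minus the image of the (unnormalized) mean curvature vector of the
vertical distribution. -/
theorem tensionField_eq_neg_differential (hJ : IsKahler J) (hθ : θ ≠ Real.pi / 2)
    (hF : IsSlantRiemannianMap E E' F J θ) (hω : IsOmegaParallel E E' F J) {p : M} {ι : Type*}
    [Fintype ι] (d : OrthonormalBasis ι ℝ (kerAt E E' F p))
    {X : ι → Π q : M, TangentSpace 𝓘(ℝ, E) q} (hX : ∀ i, IsSmoothField (X i))
    (hXV : ∀ i q, X i q ∈ kerAt E E' F q) (hXd : ∀ i, X i p = d i) :
    tensionField E E' F p = - differential E E' F p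
      (∑ i, (kerAt E E' F p)ᗮ.starProjection (leviCivita (X i) p (X i p))) := by
  have hsmooth := hF.toIsRiemannianMap.smooth
  -- The horizontal part of the trace vanishes; only the vertical basis `d` contributes below.
  have hH := sum_eq_zero_of_slant (hF.isometric p) (hJ.sq (F p)) (hJ.isometric (F p)) hθ
    (hF.angle_eq p) (secondFundamentalFormBilin hsmooth p)
    ((rangeAt E E' F p)ᗮ.starProjection.toLinearMap ∘ₗ (J (F p)).toLinearMap)
    (fun v _ w _ => secondFundamentalForm_comm hsmooth p v w)
    (fun v hv w hw => hω.secondFundamentalForm_adjoint hJ hF.toIsRiemannianMap hv hw)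
    (stdOrthonormalBasis ℝ _)
  have h := sum_orthonormalBasis_eq_add (secondFundamentalFormBilin hsmooth p) (kerAt E E' F p)
    (stdOrthonormalBasis ℝ (TangentSpace 𝓘(ℝ, E) p)) d
    (stdOrthonormalBasis ℝ (kerAt E E' F p)ᗮ)
  have hV (i : ι) : secondFundamentalFormBilin hsmooth p (d i) (d i)
      = - differential E E' F p ((kerAt E E' F p)ᗮ.starProjection
        (leviCivita (X i) p (X i p))) := by
    rw [secondFundamentalFormBilin_apply, ← hXd i]
    exact secondFundamentalForm_eq_of_vertical hsmooth (hX i) (hXV i) p _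
  refine h.trans ((congrArg₂ (· + ·) (Finset.sum_congr rfl fun i _ => hV i) hH).trans ?_)
  rw [add_zero, Finset.sum_neg_distrib, map_sum]

theorem isHarmonicMap_iff_isMinimalDistribution (hJ : IsKahler J) (hθ : θ ≠ Real.pi / 2)
    (hF : IsSlantRiemannianMap E E' F J θ) (hω : IsOmegaParallel E E' F J) :
    IsHarmonicMap E E' F ↔ IsMinimalDistribution (kerAt E E' F) := by
  constructor
  · intro h p v hv hvD hon
    have hon' : Orthonormal ℝ (fun i => (⟨v i p, hvD i p⟩ : kerAt E E' F p)) :=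
      hon.codRestrict _ _
    let d := OrthonormalBasis.mk hon'
      (hon'.linearIndependent.span_eq_top_of_card_eq_finrank' (Fintype.card_fin _)).ge
    have hd (i) : v i p = d i := by simp [d]
    have ht := tensionField_eq_neg_differential hJ hθ hF hω d hv hvD hd
    rw [h p, eq_comm, neg_eq_zero] at ht
    -- `S` is horizontal, and `ht` makes it vertical, so it is zero.
    set S := ∑ i, (kerAt E E' F p)ᗮ.starProjection (leviCivita (v i) p (v i p))
    have hS : S ∈ (kerAt E E' F p)ᗮ :=
      Submodule.sum_mem _ fun i _ => Submodule.starProjection_apply_mem _ _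
    have hS' : S ∈ kerAt E E' F p := ht
    have hS0 : S = 0 := by
      simpa using ((kerAt E E' F p).orthogonal_disjoint.le_bot ⟨hS', hS⟩)
    rw [hS0, smul_zero]
  · intro h p
    let d := stdOrthonormalBasis ℝ (kerAt E E' F p)
    choose X hX hXV hXd using fun i =>
      hF.toIsRiemannianMap.exists_vertical_field (d i).2
    have hon : Orthonormal ℝ (fun i => X i p) := by
      simp only [hXd]
      exact d.orthonormal.comp_linearIsometry (kerAt E E' F p).subtypeₗᵢ
    have hm := h p X hX hXV hon
    rw [tensionField_eq_neg_differential hJ hθ hF hω d hX hXV hXd]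
    -- In rank zero the factor `r⁻¹` is `0`, so minimality carries no information, but the vertical
    -- sum is then empty.
    rcases Nat.eq_zero_or_pos (Module.finrank ℝ (kerAt E E' F p)) with h0 | h0
    · have : IsEmpty (Fin (Module.finrank ℝ (kerAt E E' F p))) := by rw [h0]; infer_instance
      simp
    · rw [(smul_eq_zero.1 hm).resolve_left (inv_ne_zero (Nat.cast_ne_zero.2 h0.ne')), map_zero,
        neg_zero]

end Harmonic

end SlantRiemannian

end
theorem theorem3p2 {m₁ m₂ : ℕ}
    {M₁ : Type*} [TopologicalSpace M₁] [T2Space M₁]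
    [ChartedSpace (EuclideanSpace ℝ (Fin m₁)) M₁] [IsManifold (𝓡 m₁) ∞ M₁]
    [RiemannianBundle (fun x : M₁ => TangentSpace (𝓡 m₁) x)]
    [IsContMDiffRiemannianBundle (𝓡 m₁) ∞ (EuclideanSpace ℝ (Fin m₁))
      (fun x : M₁ => TangentSpace (𝓡 m₁) x)]
    {M₂ : Type*} [TopologicalSpace M₂] [T2Space M₂]
    [ChartedSpace (EuclideanSpace ℝ (Fin m₂)) M₂] [IsManifold (𝓡 m₂) ∞ M₂]
    [RiemannianBundle (fun y : M₂ => TangentSpace (𝓡 m₂) y)]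
    [IsContMDiffRiemannianBundle (𝓡 m₂) ∞ (EuclideanSpace ℝ (Fin m₂))
      (fun y : M₂ => TangentSpace (𝓡 m₂) y)]
    (J : Π y : M₂, TangentSpace (𝓡 m₂) y →L[ℝ] TangentSpace (𝓡 m₂) y)
    (hJ : SlantRiemannian.IsKahler J)
    (F : M₁ → M₂) (θ : ℝ) (hθ : θ ≠ Real.pi / 2)
    (hF : SlantRiemannian.IsSlantRiemannianMap
      (EuclideanSpace ℝ (Fin m₁)) (EuclideanSpace ℝ (Fin m₂)) F J θ)
    (hω : SlantRiemannian.IsOmegaParallel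
      (EuclideanSpace ℝ (Fin m₁)) (EuclideanSpace ℝ (Fin m₂)) F J) :
    SlantRiemannian.IsHarmonicMap (EuclideanSpace ℝ (Fin m₁)) (EuclideanSpace ℝ (Fin m₂)) F ↔
      SlantRiemannian.IsMinimalDistribution (SlantRiemannian.kerAt
        (EuclideanSpace ℝ (Fin m₁)) (EuclideanSpace ℝ (Fin m₂)) F) :=
  SlantRiemannian.isHarmonicMap_iff_isMinimalDistribution hJ hθ hF hω
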